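/- Let $n\geq 1$, let $p$ be a prime and let $\lambda$ be a partition of $n$ with transpose $\lambda'$. Let $M^\lambda$ be the free $\mathbb{Z}$-module on the $\lambda$-tabloids (tableaux with unordered rows) $\{a\}$, with the entrywise operation of the symmetric group $\mathcal{S}_n$ and with the bilinear form $(-,=)$ for which the tabloids are orthonormal. The Specht module $S^\lambda\subseteq M^\lambda$ is the $\mathbb{Z}$-span of the polytabloids $\sum_{\sigma\in C_a}\varepsilon_\sigma\,\sigma\{a\}$, where $a$ runs over the $\lambda$-tableaux, $C_a$ is the column stabilizer of $a$ and $\varepsilon_\sigma$ is the sign of $\sigma$. Write $n_\lambda:=\operatorname{rk}_{\mathbb{Z}}S^\lambda$, let $S^{\lambda,*}:=\operatorname{Hom}_{\mathbb{Z}}(S^\lambda,\mathbb{Z})$, let $\eta:S^\lambda\to S^{\lambda,*}$, $\xi\mapsto(\xi,-)$, and for a commutative ring $A$ put $S^\lambda_A:=A\otimes_{\mathbb{Z}}S^\lambda$ and $S^{\lambda,*}_A:=A\otimes_{\mathbb{Z}}S^{\lambda,*}$. For $i\geq 0$, the $i$-th piece of the Jantzen filtration of $S^\lambda_{\mathbb{F}_p}=S^\lambda_{\mathbb{Z}_{(p)}}/pS^\lambda_{\mathbb{Z}_{(p)}}$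 is the $\mathbb{F}_p\mathcal{S}_n$-submodule $$S^\lambda_{\mathbb{F}_p}(i):=\bigl(\eta^{-1}(p^iS^{\lambda,*}_{\mathbb{Z}_{(p)}})+pS^\lambda_{\mathbb{Z}_{(p)}}\bigr)/pS^\lambda_{\mathbb{Z}_{(p)}}\subseteq S^\lambda_{\mathbb{F}_p},$$ where $\eta$ also denotes the induced map $S^\lambda_{\mathbb{Z}_{(p)}}\to S^{\lambda,*}_{\mathbb{Z}_{(p)}}$. For an $\mathcal{S}_n$-module $X$ write $X^-:=X\otimes_{\mathbb{Z}}S^{(1^n)}$ (the sign twist of $X$). Then $n_\lambda$ divides $n!$, and with $N:=v_p(n!/n_\lambda)$ the following holds. For every integer $i$ with $0\leq i\leq N$ there is an isomorphism of $\mathbb{F}_p\mathcal{S}_n$-modules $$\frac{S^\lambda_{\mathbb{F}_p}(i)}{S^\lambda_{\mathbb{F}_p}(i+1)}\;\cong\;\left(\frac{S^{\lambda'}_{\mathbb{F}_p}(N-i)}{S^{\lambda'}_{\mathbb{F}_p}(N-i+1)}\right)^{-},$$ and for every integer $i>N$ we have $S^\lambda_{\mathbb{F}_p}(i)/S^\lambda_{\mathbb{F}_p}(i+1)=0$.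 -/

import Mathlib

open scoped TensorProduct Pointwise Nat

noncomputable section

namespace SpechtJantzen

/-! ### Tableaux, tabloids and the permutation module -/

/-- A `lam`-tableau with entries in `Fin n`: a bijective filling of the cells of the Young diagram
`lam` (the cell `(r, c)` lies in row `r` and column `c`). -/
abbrev Tableau (lam : YoungDiagram) (n : ℕ) : Type := {c : ℕ × ℕ // c ∈ lam.cells} ≃ Fin n

namespace Tableau

variable {lam : YoungDiagram} {n : ℕ}

/-- The row of the tableau `a` that contains the entry `x`. -/
def rowOf (a : Tableau lam n) (x : Fin n) : ℕ := (a.symm x).1.1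

/-- The column of the tableau `a` that contains the entry `x`. -/
def colOf (a : Tableau lam n) (x : Fin n) : ℕ := (a.symm x).1.2

/-- Entrywise operation of a permutation on a tableau. -/
def perm (g : Equiv.Perm (Fin n)) (a : Tableau lam n) : Tableau lam n := a.trans g

/-- The column stabilizer of a tableau: the permutations of the entries that map every entry to an
entry in the same column. -/
def columnStabilizer (a : Tableau lam n) : Subgroup (Equiv.Perm (Fin n)) where
  carrier := {g | ∀ x, a.colOf (g x) = a.colOf x}
  mul_mem' {g h} hg hh x := by
    rw [Equiv.Perm.mul_apply, hg, hh]
  one_mem' _ := rfl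
  inv_mem' {g} hg x := by
    have := hg (g⁻¹ x)
    rwa [← Equiv.Perm.mul_apply, mul_inv_cancel, Equiv.Perm.one_apply, eq_comm] at this

theorem rowOf_perm (g : Equiv.Perm (Fin n)) (a : Tableau lam n) (x : Fin n) :
    (a.perm g).rowOf x = a.rowOf (g⁻¹ x) := rfl

theorem colOf_perm (g : Equiv.Perm (Fin n)) (a : Tableau lam n) (x : Fin n) :
    (a.perm g).colOf x = a.colOf (g⁻¹ x) := rfl

end Tableau

/-- Two tableaux are row equivalent if every entry lies in the same row of both of them. -/
def rowSetoid (lam : YoungDiagram) (n : ℕ) : Setoid (Tableau lam n) where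
  r a b := ∀ x, a.rowOf x = b.rowOf x
  iseqv := ⟨fun _ _ => rfl, fun h x => (h x).symm, fun h h' x => (h x).trans (h' x)⟩

/-- A tabloid: a tableau with unordered rows. -/
def Tabloid (lam : YoungDiagram) (n : ℕ) : Type := Quotient (rowSetoid lam n)

/-- The tabloid `{a}` of a tableau `a`. -/
def Tabloid.mk {lam : YoungDiagram} {n : ℕ} (a : Tableau lam n) : Tabloid lam n :=
  Quotient.mk (rowSetoid lam n) a

/-- The symmetric group operates entrywise on tabloids. -/
instance (lam : YoungDiagram) (n : ℕ) : MulAction (Equiv.Perm (Fin n)) (Tabloid lam n) where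
  smul g := Quotient.map (Tableau.perm g) fun a b h x => by
    rw [Tableau.rowOf_perm, Tableau.rowOf_perm]; exact h _
  one_smul t := by
    induction t using Quotient.inductionOn
    rfl
  mul_smul g h t := by
    induction t using Quotient.inductionOn
    rfl

theorem Tabloid.smul_mk {lam : YoungDiagram} {n : ℕ} (g : Equiv.Perm (Fin n))
    (a : Tableau lam n) : g • Tabloid.mk a = Tabloid.mk (a.perm g) := rfl

/-- The free `ℤ`-module `M^lam` on the set of `lam`-tabloids. -/
abbrev TabloidModule (lam : YoungDiagram) (n : ℕ) : Type := Tabloid lam n →₀ ℤ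

/-- The representation of the symmetric group on `M^lam`. -/
def tabloidRep (lam : YoungDiagram) (n : ℕ) :
    Representation ℤ (Equiv.Perm (Fin n)) (TabloidModule lam n) where
  toFun g := Finsupp.lmapDomain ℤ ℤ (g • ·)
  map_one' := by ext; simp
  map_mul' g h := by ext; simp [mul_smul]

theorem tabloidRep_single {lam : YoungDiagram} {n : ℕ} (g : Equiv.Perm (Fin n))
    (t : Tabloid lam n) (c : ℤ) :
    tabloidRep lam n g (Finsupp.single t c) = Finsupp.single (g • t) c := by
  simp [tabloidRep]

/-- The bilinear form on `M^lam` for which the tabloids form an orthonormal basis,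
`(x, y) = ∑ t, x t * y t`, regarded as a map from `M^lam` to its dual. -/
def tabloidForm (lam : YoungDiagram) (n : ℕ) :
    TabloidModule lam n →ₗ[ℤ] Module.Dual ℤ (TabloidModule lam n) :=
  Finsupp.linearCombination ℤ fun t => Finsupp.lapply t

open Classical in
theorem tabloidForm_single (lam : YoungDiagram) (n : ℕ) (s t : Tabloid lam n) :
    tabloidForm lam n (Finsupp.single s 1) (Finsupp.single t 1) = if s = t then 1 else 0 := by
  simp [tabloidForm, Finsupp.single_apply, eq_comm]

theorem tabloidForm_invariant {lam : YoungDiagram} {n : ℕ} (g : Equiv.Perm (Fin n))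
    (x y : TabloidModule lam n) :
    tabloidForm lam n (tabloidRep lam n g x) y
      = tabloidForm lam n x (tabloidRep lam n g⁻¹ y) := by
  classical
  induction x using Finsupp.induction_linear with
  | zero => simp
  | add x₁ x₂ h₁ h₂ => simp only [map_add, LinearMap.add_apply, h₁, h₂]
  | single s c =>
    induction y using Finsupp.induction_linear with
    | zero => simp
    | add y₁ y₂ h₁ h₂ => simp only [map_add, h₁, h₂]
    | single t d =>
      simp only [tabloidRep_single, tabloidForm, Finsupp.linearCombination_single,
        LinearMap.smul_apply, Finsupp.lapply_apply, Finsupp.single_apply, inv_smul_eq_iff]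

/-! ### Specht modules over `ℤ` -/

open Classical in
/-- The polytabloid attached to a tableau `a`: the alternating sum of the tabloids `g • {a}` over
the column stabilizer of `a`. -/
def polytabloid {lam : YoungDiagram} {n : ℕ} (a : Tableau lam n) : TabloidModule lam n :=
  ∑ g : a.columnStabilizer,
    Finsupp.single ((g : Equiv.Perm (Fin n)) • Tabloid.mk a)
      (Equiv.Perm.sign (g : Equiv.Perm (Fin n)) : ℤ)

theorem tabloidRep_polytabloid {lam : YoungDiagram} {n : ℕ} (g : Equiv.Perm (Fin n))
    (a : Tableau lam n) : tabloidRep lam n g (polytabloid a) = polytabloid (a.perm g) := by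
  classical
  have hmem : ∀ h : Equiv.Perm (Fin n),
      h ∈ a.columnStabilizer ↔ MulAut.conj g h ∈ (a.perm g).columnStabilizer := by
    intro h
    have key : ∀ x, g⁻¹ ((g * h * g⁻¹) x) = h (g⁻¹ x) := fun x => by
      rw [← Equiv.Perm.mul_apply, ← Equiv.Perm.mul_apply]
      congr 1
      group
    constructor
    · intro hh x
      rw [Tableau.colOf_perm, Tableau.colOf_perm, MulAut.conj_apply, key]
      exact hh _
    · intro hh x
      have := hh (g x)
      rwa [Tableau.colOf_perm, Tableau.colOf_perm, MulAut.conj_apply, key,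
        ← Equiv.Perm.mul_apply g⁻¹ g, inv_mul_cancel, Equiv.Perm.one_apply] at this
  let e : a.columnStabilizer ≃ (a.perm g).columnStabilizer :=
    (MulAut.conj g).toEquiv.subtypeEquiv hmem
  unfold polytabloid
  rw [map_sum]
  refine Fintype.sum_equiv e _ _ fun h => ?_
  have he : ((e h : (a.perm g).columnStabilizer) : Equiv.Perm (Fin n)) = g * h * g⁻¹ := rfl
  rw [tabloidRep_single, he, ← Tabloid.smul_mk, smul_smul, smul_smul]
  congr 1
  · simp
  · rw [Equiv.Perm.sign_mul, Equiv.Perm.sign_mul, Equiv.Perm.sign_inv, mul_right_comm,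
      Int.units_mul_self, one_mul]

/-- The Specht module `S^lam`, the `ℤ`-span of the polytabloids, as a subrepresentation of
`M^lam`. -/
def spechtSub (lam : YoungDiagram) (n : ℕ) : Subrepresentation (tabloidRep lam n) where
  toSubmodule := Submodule.span ℤ (Set.range (polytabloid (lam := lam) (n := n)))
  apply_mem_toSubmodule g v hv := by
    have h : Submodule.span ℤ (Set.range (polytabloid (lam := lam) (n := n))) ≤
        (Submodule.span ℤ (Set.range (polytabloid (lam := lam) (n := n)))).comap
          (tabloidRep lam n g) := by
      rw [Submodule.span_le]
      rintro _ ⟨a, rfl⟩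
      rw [SetLike.mem_coe, Submodule.mem_comap, tabloidRep_polytabloid]
      exact Submodule.subset_span ⟨_, rfl⟩
    exact h hv

/-- The underlying abelian group of `S^lam`. -/
abbrev Specht (lam : YoungDiagram) (n : ℕ) : Type := (spechtSub lam n).toSubmodule

/-- The representation of the symmetric group on `S^lam`. -/
abbrev spechtRep (lam : YoungDiagram) (n : ℕ) :
    Representation ℤ (Equiv.Perm (Fin n)) (Specht lam n) :=
  (spechtSub lam n).toRepresentation

/-- The `ℤ`-rank of `S^lam`. -/
def spechtRank (lam : YoungDiagram) (n : ℕ) : ℕ := Module.finrank ℤ (Specht lam n)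

/-- The equivariant map `η : S^lam → S^{lam,*}`, `x ↦ (x, -)`, into the dual lattice given by the
restriction of the bilinear form of `M^lam`. -/
def eta (lam : YoungDiagram) (n : ℕ) :
    (spechtRep lam n).IntertwiningMap (spechtRep lam n).dual :=
  LinearMap.intertwiningMap_of_isIntertwiningMap _ _
    ((tabloidForm lam n).domRestrict₁₂ (spechtSub lam n).toSubmodule (spechtSub lam n).toSubmodule)
    (fun g x => by
      ext y
      exact tabloidForm_invariant g x.1 y.1)

/-! ### Base change and the sign twist -/

/-- The base change `A ⊗ ρ` of an integral representation to a commutative ring `A`. -/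
def baseChangeRep (A : Type*) [CommRing A] {G X : Type*} [Group G] [AddCommGroup X]
    (ρ : Representation ℤ G X) : Representation A G (A ⊗[ℤ] X) where
  toFun g := (ρ g).baseChange A
  map_one' := by ext; simp
  map_mul' g h := by ext; simp

/-- The column diagram `(1^n)`. -/
def columnDiagram (n : ℕ) : YoungDiagram where
  cells := Finset.range n ×ˢ {0}
  isLowerSet := by
    rintro ⟨i, j⟩ ⟨i', j'⟩ ⟨h₁, h₂⟩ h
    simp only [Finset.coe_product, Finset.coe_range, Finset.coe_singleton, Set.mem_prod,
      Set.mem_Iio, Set.mem_singleton_iff] at h h₁ h₂ ⊢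
    omega

/-- The sign twist `X^- = X ⊗_ℤ S^{(1^n)}` of a representation of the symmetric group, with
diagonal operation and with scalars acting on `X`. -/
def signTwist {k X : Type*} [CommRing k] [AddCommGroup X] [Module k X] {n : ℕ}
    (ρ : Representation k (Equiv.Perm (Fin n)) X) :
    Representation k (Equiv.Perm (Fin n)) (X ⊗[ℤ] Specht (columnDiagram n) n) where
  toFun g := TensorProduct.AlgebraTensorModule.map (ρ g) (spechtRep (columnDiagram n) n g)
  map_one' := by
    rw [map_one, map_one]
    exact TensorProduct.AlgebraTensorModule.map_id
  map_mul' g h := by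
    rw [map_mul, map_mul]
    exact TensorProduct.AlgebraTensorModule.map_comp _ _ _ _

/-! ### The Jantzen filtration -/

section Jantzen

variable (p : ℕ) [Fact p.Prime]

instance isPrime_span : (Ideal.span {(p : ℤ)}).IsPrime :=
  (Ideal.span_singleton_prime (Nat.cast_ne_zero.mpr (Fact.out : p.Prime).ne_zero)).mpr
    (Nat.prime_iff_prime_int.mp Fact.out)

/-- The ring `ℤ_(p)`, the localization of `ℤ` at the prime ideal `(p)`. -/
def ZLoc : Type := Localization.AtPrime (Ideal.span {(p : ℤ)})

instance : CommRing (ZLoc p) :=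
  inferInstanceAs (CommRing (Localization.AtPrime (Ideal.span {(p : ℤ)})))

instance : IsLocalization.AtPrime (ZLoc p) (Ideal.span {(p : ℤ)}) := by
  have h : IsLocalization.AtPrime (Localization.AtPrime (Ideal.span {(p : ℤ)}))
    (Ideal.span {(p : ℤ)}) := inferInstance
  have e : (OreLocalization.instAlgebra :
      Algebra ℤ (Localization.AtPrime (Ideal.span {(p : ℤ)}))) = Ring.toIntAlgebra _ :=
    Subsingleton.elim _ _
  rw [e] at h
  exact h

/-- The residue map `ℤ_(p) → 𝔽_p`. -/
def residueMap : ZLoc p →+* ZMod p :=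
  IsLocalization.lift (M := (Ideal.span {(p : ℤ)}).primeCompl) (g := Int.castRingHom (ZMod p))
    fun y => by
      refine IsUnit.mk0 _ fun h => y.2 ?_
      rw [SetLike.mem_coe, Ideal.mem_span_singleton]
      exact (ZMod.intCast_zmod_eq_zero_iff_dvd _ _).mp h

instance : RingHomSurjective (residueMap p) where
  is_surjective x := by
    obtain ⟨m, rfl⟩ := ZMod.intCast_surjective x
    exact ⟨m, map_intCast _ m⟩

/-- The reduction map `ℤ_(p) ⊗ X → 𝔽_p ⊗ X` for an abelian group `X`. It is surjective with kernel
`p (ℤ_(p) ⊗ X)`, so that it identifies `𝔽_p ⊗ X` with `(ℤ_(p) ⊗ X) / p (ℤ_(p) ⊗ X)`. -/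
def reduction (X : Type*) [AddCommGroup X] :
    (ZLoc p ⊗[ℤ] X) →ₛₗ[residueMap p] (ZMod p ⊗[ℤ] X) where
  toFun := TensorProduct.map (residueMap p).toIntAlgHom.toLinearMap LinearMap.id
  map_add' := map_add _
  map_smul' c x := by
    induction x using TensorProduct.induction_on with
    | zero => simp
    | tmul a x => simp [TensorProduct.smul_tmul']
    | add x y hx hy => rw [smul_add, map_add, hx, hy, map_add, smul_add]

theorem reduction_tmul {X : Type*} [AddCommGroup X] (c : ZLoc p) (x : X) :
    reduction p X (c ⊗ₜ[ℤ] x) = residueMap p c ⊗ₜ[ℤ] x := rfl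

theorem reduction_baseChangeRep {G X : Type*} [Group G] [AddCommGroup X]
    (ρ : Representation ℤ G X) (g : G) (x : ZLoc p ⊗[ℤ] X) :
    reduction p X (baseChangeRep (ZLoc p) ρ g x)
      = baseChangeRep (ZMod p) ρ g (reduction p X x) := by
  induction x using TensorProduct.induction_on with
  | zero => simp
  | tmul a x => rfl
  | add x y hx hy => simp only [map_add, hx, hy]

/-- The preimage `(p^i Y) η⁻¹ ⊆ X`, where `η : X → Y` is the map
`S^lam_{ℤ_(p)} → S^{lam,*}_{ℤ_(p)}`. -/
def jantzenPreimage (lam : YoungDiagram) (n i : ℕ) :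
    Submodule (ZLoc p) (ZLoc p ⊗[ℤ] Specht lam n) :=
  (((p : ZLoc p) ^ i) • (⊤ : Submodule (ZLoc p) (ZLoc p ⊗[ℤ] Module.Dual ℤ (Specht lam n)))).comap
    ((eta lam n).toLinearMap.baseChange (ZLoc p))

theorem jantzenPreimage_stable {lam : YoungDiagram} {n i : ℕ} (g : Equiv.Perm (Fin n))
    {x : ZLoc p ⊗[ℤ] Specht lam n} (hx : x ∈ jantzenPreimage p lam n i) :
    baseChangeRep (ZLoc p) (spechtRep lam n) g x ∈ jantzenPreimage p lam n i := by
  obtain ⟨y, -, hy⟩ := hx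
  refine ⟨baseChangeRep (ZLoc p) (spechtRep lam n).dual g y, Submodule.mem_top, ?_⟩
  have hcomm : (eta lam n).toLinearMap.baseChange (ZLoc p)
        (baseChangeRep (ZLoc p) (spechtRep lam n) g x)
      = baseChangeRep (ZLoc p) (spechtRep lam n).dual g
        ((eta lam n).toLinearMap.baseChange (ZLoc p) x) := by
    have h := congrArg (LinearMap.baseChange (ZLoc p)) ((eta lam n).isIntertwining' g)
    rw [LinearMap.baseChange_comp, LinearMap.baseChange_comp] at h
    exact LinearMap.congr_fun h x
  rw [hcomm, ← hy]
  exact ((baseChangeRep (ZLoc p) (spechtRep lam n).dual g).map_smul _ _).symm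

/-- The `i`-th piece `S^lam_{𝔽_p}(i)` of the Jantzen filtration of `S^lam_{𝔽_p} = 𝔽_p ⊗ S^lam`: the
image of `(p^i S^{lam,*}_{ℤ_(p)}) η⁻¹` in `S^lam_{𝔽_p} = S^lam_{ℤ_(p)} / p S^lam_{ℤ_(p)}`. -/
def jantzen (lam : YoungDiagram) (n i : ℕ) :
    Subrepresentation (baseChangeRep (ZMod p) (spechtRep lam n)) where
  toSubmodule := (jantzenPreimage p lam n i).map (reduction p (Specht lam n))
  apply_mem_toSubmodule g := by
    rintro _ ⟨x, hx, rfl⟩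
    exact ⟨_, jantzenPreimage_stable p g hx, reduction_baseChangeRep p _ g x⟩

/-- The underlying `𝔽_p`-vector space of the `i`-th Jantzen subquotient
`S^lam_{𝔽_p}(i) / S^lam_{𝔽_p}(i + 1)`. -/
abbrev JantzenSubquotient (lam : YoungDiagram) (n i : ℕ) : Type :=
  (jantzen p lam n i).toSubmodule ⧸
    (jantzen p lam n (i + 1)).toSubmodule.submoduleOf (jantzen p lam n i).toSubmodule

/-- The representation of the symmetric group on the `i`-th Jantzen subquotient. -/
abbrev jantzenSubquotientRep (lam : YoungDiagram) (n i : ℕ) :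
    Representation (ZMod p) (Equiv.Perm (Fin n)) (JantzenSubquotient p lam n i) :=
  (jantzen p lam n i).toRepresentation.quotient _
    fun g _ hx => (jantzen p lam n (i + 1)).apply_mem_toSubmodule g hx

end Jantzen

end SpechtJantzen

end

noncomputable section

namespace SpechtJantzen

open Equiv

/-! ### Reflection of tableaux, signs, and the incidence matrix of row and column tabloids. -/

section Tableaux

variable {lam mu : YoungDiagram} {n : ℕ}

/-! Let T be the matrix with rows indexed by the tabloids of λ and columns by those of λ', with one
entry ±1 for each tableau, at its row tabloid and column tabloid. Its columns are the polytabloids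
up to sign, so S^λ is the image of T, and S^{λ'} is the image of the transpose T'. Both maps commute
with the symmetric group up to the sign character.

Every sign-equivariant matrix of this format is a multiple of T (`eq_mul_incidence`). Hence T T' T =
m T for an integer m, and the trace of T T' equals m n_λ. This trace is also the sum of the squared
entries of T, that is, the number n! of tableaux. So m = n!/n_λ.

S^λ is pure in M^λ (`specht_pure`), so every functional on S^λ is of the form (v,-) with v in M^λ.
The functional vanishes exactly when T' v = 0, which identifies S^{λ,*} with S^{λ'} and η with the
restriction φ of T' (`exists_dual_equiv`). With ψ the restriction of T, both ψφ and φψ are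
multiplication by m.

Over ℤ_(p), m is p^N times a unit. If φ x = p^i y, then ψ y is a unit multiple of p^{N-i} x. So x ↦
p^{-i} φ x matches the Jantzen pieces of degree i and N-i, up to the sign twist carried by φ; for i
> N the same computation gives that x is divisible by p. -/

theorem mem_of_eq_transpose (h : mu = lam.transpose) (c : ℕ × ℕ) :
    c ∈ mu.cells ↔ c.swap ∈ lam.cells := by
  rw [h, YoungDiagram.mem_cells, YoungDiagram.mem_cells, YoungDiagram.mem_transpose]

/-- The tableau of transposed shape obtained by reflecting a tableau at the diagonal. -/
def Tableau.tr (h : mu = lam.transpose) (a : Tableau lam n) : Tableau mu n :=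
  Equiv.trans
    { toFun := fun c => ⟨c.1.swap, (mem_of_eq_transpose h c.1).mp c.2⟩
      invFun := fun c => ⟨c.1.swap, (mem_of_eq_transpose h c.1.swap).mpr c.2⟩
      left_inv := fun _ => rfl
      right_inv := fun _ => rfl } a

/-- The two diagrams are kept as variables linked by an equation, so that every result can be reused
with `lam` and `mu` exchanged, without casts along the double transpose. -/
theorem eq_transpose_symm (h : mu = lam.transpose) : lam = mu.transpose := by
  rw [h, YoungDiagram.transpose_transpose]

theorem Tableau.rowOf_tr (h : mu = lam.transpose) (a : Tableau lam n) :
    (a.tr h).rowOf = a.colOf := rfl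

theorem Tableau.tr_tr (h : mu = lam.transpose) (a : Tableau lam n) :
    (a.tr h).tr (eq_transpose_symm h) = a := rfl

theorem Tableau.tr_perm (h : mu = lam.transpose) (g : Perm (Fin n)) (a : Tableau lam n) :
    (a.perm g).tr h = (a.tr h).perm g := rfl

/-- Reflection at the diagonal as an equivalence. -/
def Tableau.trEquiv (h : mu = lam.transpose) : Tableau lam n ≃ Tableau mu n where
  toFun := Tableau.tr h
  invFun := Tableau.tr (eq_transpose_symm h)
  left_inv _ := rfl
  right_inv _ := rfl

theorem Tableau.trEquiv_apply (h : mu = lam.transpose) (a : Tableau lam n) :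
    trEquiv h a = a.tr h := rfl

theorem Tableau.mem_shape (a : Tableau lam n) (x : Fin n) : (a.rowOf x, a.colOf x) ∈ lam :=
  (a.symm x).2

theorem Tableau.colOf_lt (a : Tableau lam n) (x : Fin n) : a.colOf x < lam.rowLen (a.rowOf x) :=
  YoungDiagram.mem_iff_lt_rowLen.mp (a.mem_shape x)

theorem Tableau.rowOf_lt (a : Tableau lam n) (x : Fin n) : a.rowOf x < lam.colLen (a.colOf x) :=
  YoungDiagram.mem_iff_lt_colLen.mp (a.mem_shape x)

theorem Tableau.exists_entry (a : Tableau lam n) {i j : ℕ} (h : (i, j) ∈ lam) :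
    ∃ x, a.rowOf x = i ∧ a.colOf x = j :=
  ⟨a ⟨(i, j), h⟩, by simp [rowOf], by simp [colOf]⟩

theorem Tableau.entry_ext (a : Tableau lam n) {x y : Fin n} (h₁ : a.rowOf x = a.rowOf y)
    (h₂ : a.colOf x = a.colOf y) : x = y :=
  a.symm.injective (Subtype.ext (Prod.ext h₁ h₂))

theorem Tableau.ext_rowOf_colOf {a b : Tableau lam n} (h₁ : a.rowOf = b.rowOf)
    (h₂ : a.colOf = b.colOf) : a = b := by
  have : a.symm = b.symm := by
    ext1 x
    exact Subtype.ext (Prod.ext (congrFun h₁ x) (congrFun h₂ x))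
  rw [← a.symm_symm, this, b.symm_symm]

theorem Tableau.exists_perm (a b : Tableau lam n) : ∃ g, b = a.perm g :=
  ⟨a.symm.trans b, by ext x; simp [perm]⟩

theorem Tableau.perm_one (a : Tableau lam n) : a.perm 1 = a := rfl

theorem Tableau.perm_mul (a : Tableau lam n) (g h : Perm (Fin n)) :
    a.perm (g * h) = (a.perm h).perm g := rfl

theorem Tableau.perm_injective (a : Tableau lam n) : Function.Injective fun g => a.perm g := by
  intro g h hgh
  ext x
  have := congrArg (fun b : Tableau lam n => b (a.symm x)) hgh
  simpa [perm] using congrArg Fin.val this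

theorem Tabloid.mk_eq_mk {a b : Tableau lam n} :
    Tabloid.mk a = Tabloid.mk b ↔ a.rowOf = b.rowOf :=
  Quotient.eq.trans funext_iff.symm

theorem Tabloid.exists_mk (s : Tabloid lam n) : ∃ a, Tabloid.mk a = s := Quotient.exists_rep s

instance : Finite (Tableau lam n) := Equiv.finite_left

instance : Finite (Tabloid lam n) := inferInstanceAs (Finite (Quotient _))

instance : Fintype (Tableau lam n) := Fintype.ofFinite _

instance : Fintype (Tabloid lam n) := Fintype.ofFinite _

/-- The entrywise operation of a permutation, as a permutation of the set of tableaux. -/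
def Tableau.permEquiv (g : Perm (Fin n)) : Tableau lam n ≃ Tableau lam n where
  toFun := Tableau.perm g
  invFun := Tableau.perm g⁻¹
  left_inv a := by rw [← Tableau.perm_mul]; simp [Tableau.perm_one]
  right_inv a := by rw [← Tableau.perm_mul]; simp [Tableau.perm_one]

/-- The sign of the permutation that carries the tableau `u₀` to the tableau `u`. -/
def Tableau.sgn (u₀ u : Tableau lam n) : ℤ := Perm.sign (u₀.symm.trans u)

theorem Tableau.sgn_perm (u₀ u : Tableau lam n) (g : Perm (Fin n)) :
    sgn u₀ (u.perm g) = Perm.sign g * sgn u₀ u := by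
  have : u₀.symm.trans (u.perm g) = g * (u₀.symm.trans u) := rfl
  rw [sgn, this, Perm.sign_mul, Units.val_mul, sgn]

theorem Tableau.sgn_self (u₀ : Tableau lam n) : sgn u₀ u₀ = 1 := by
  simp [sgn]

theorem Tableau.sgn_mul_self (u₀ u : Tableau lam n) : sgn u₀ u * sgn u₀ u = 1 := by
  rw [sgn, ← Units.val_mul, Int.units_mul_self, Units.val_one]

theorem Tableau.sgn_tr (h : mu = lam.transpose) (u₀ u : Tableau lam n) :
    sgn (u₀.tr h) (u.tr h) = sgn u₀ u := rfl

theorem sign_mul_sign (g : Perm (Fin n)) : (Perm.sign g : ℤ) * Perm.sign g = 1 := by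
  rw [← Units.val_mul, Int.units_mul_self, Units.val_one]

open Classical in
/-- The incidence matrix between row tabloids and column tabloids: the entry at `(s, t)` is the
sign of the unique tableau with row tabloid `s` and column tabloid `t`, and zero if there is none.
The columns of this matrix are the polytabloids up to sign. -/
def incidence (h : mu = lam.transpose) (u₀ : Tableau lam n) (s : Tabloid lam n)
    (t : Tabloid mu n) : ℤ :=
  ∑ u : Tableau lam n, if Tabloid.mk u = s ∧ Tabloid.mk (u.tr h) = t then u₀.sgn u else 0

theorem Tableau.eq_of_mk_eq (h : mu = lam.transpose) {u v : Tableau lam n}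
    (h₁ : Tabloid.mk u = Tabloid.mk v) (h₂ : Tabloid.mk (u.tr h) = Tabloid.mk (v.tr h)) : u = v :=
  ext_rowOf_colOf (Tabloid.mk_eq_mk.mp h₁) (Tabloid.mk_eq_mk.mp h₂)

theorem incidence_mk (h : mu = lam.transpose) (u₀ u : Tableau lam n) :
    incidence h u₀ (Tabloid.mk u) (Tabloid.mk (u.tr h)) = u₀.sgn u := by
  classical
  unfold incidence
  rw [Finset.sum_eq_single u, if_pos ⟨rfl, rfl⟩]
  · exact fun v _ hv => if_neg fun hh => hv (Tableau.eq_of_mk_eq h hh.1 hh.2)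
  · simp

theorem incidence_ne_zero {h : mu = lam.transpose} {u₀ : Tableau lam n} {s : Tabloid lam n}
    {t : Tabloid mu n} (hst : incidence h u₀ s t ≠ 0) :
    ∃ u, Tabloid.mk u = s ∧ Tabloid.mk (u.tr h) = t := by
  by_contra! hh
  exact hst (Finset.sum_eq_zero fun u _ => if_neg fun hu => hh u hu.1 hu.2)

theorem incidence_tr (h : mu = lam.transpose) (u₀ : Tableau lam n) (s : Tabloid lam n)
    (t : Tabloid mu n) :
    incidence (eq_transpose_symm h) (u₀.tr h) t s = incidence h u₀ s t := by
  classical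
  unfold incidence
  refine (Fintype.sum_equiv (Tableau.trEquiv h) _ _ fun u => ?_).symm
  simp only [Tableau.trEquiv_apply, Tableau.tr_tr, Tableau.sgn_tr, and_comm]

theorem incidence_smul (h : mu = lam.transpose) (u₀ : Tableau lam n) (g : Perm (Fin n))
    (s : Tabloid lam n) (t : Tabloid mu n) :
    incidence h u₀ (g • s) (g • t) = Perm.sign g * incidence h u₀ s t := by
  classical
  unfold incidence
  rw [Finset.mul_sum]
  refine (Fintype.sum_equiv (Tableau.permEquiv g) _ _ fun u => ?_).symm
  simp only [Tableau.permEquiv, coe_fn_mk, Tableau.tr_perm, ← Tabloid.smul_mk, Tableau.sgn_perm,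
    smul_left_cancel_iff, mul_ite, mul_zero]

/-! ### The combinatorial lemma -/

theorem card_filter_rowOf (a : Tableau lam n) (i : ℕ) :
    (Finset.univ.filter fun x => a.rowOf x = i).card = lam.rowLen i := by
  rw [← Finset.card_range (lam.rowLen i)]
  refine Finset.card_bij (fun x _ => a.colOf x) ?_ ?_ ?_
  · intro x hx
    rw [Finset.mem_filter] at hx
    rw [Finset.mem_range, ← hx.2]
    exact a.colOf_lt x
  · intro x hx y hy hxy
    rw [Finset.mem_filter] at hx hy
    exact a.entry_ext (hx.2.trans hy.2.symm) hxy
  · intro j hj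
    obtain ⟨x, hx₁, hx₂⟩ := a.exists_entry
      (YoungDiagram.mem_iff_lt_rowLen.mpr (Finset.mem_range.mp hj))
    exact ⟨x, by simp [hx₁], hx₂⟩

theorem card_filter_rowOf_colOf_lt (a : Tableau lam n) (i k : ℕ) :
    (Finset.univ.filter fun x => a.rowOf x = i ∧ a.colOf x < k).card = min (lam.rowLen i) k := by
  rw [← Finset.card_range (min (lam.rowLen i) k)]
  refine Finset.card_bij (fun x _ => a.colOf x) ?_ ?_ ?_
  · intro x hx
    simp only [Finset.mem_filter, Finset.mem_univ, true_and] at hx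
    rw [Finset.mem_range, ← hx.1]
    exact lt_min (a.colOf_lt x) hx.2
  · intro x hx y hy hxy
    simp only [Finset.mem_filter, Finset.mem_univ, true_and] at hx hy
    exact a.entry_ext (hx.1.trans hy.1.symm) hxy
  · intro j hj
    rw [Finset.mem_range, lt_min_iff] at hj
    obtain ⟨x, hx₁, hx₂⟩ := a.exists_entry (YoungDiagram.mem_iff_lt_rowLen.mpr hj.1)
    exact ⟨x, by simp [hx₁, hx₂, hj.2], hx₂⟩

theorem Tabloid.swap_smul_mk (a : Tableau lam n) {x y : Fin n} (h : a.rowOf x = a.rowOf y) :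
    Equiv.swap x y • Tabloid.mk a = Tabloid.mk a := by
  rw [Tabloid.smul_mk, Tabloid.mk_eq_mk]
  ext z
  rw [Tableau.rowOf_perm, Equiv.swap_inv, Equiv.swap_apply_def]
  split_ifs with e₁ e₂
  · rw [e₁, h]
  · rw [e₂, h]
  · rfl

/-- If every row of `a` meets every column of `b` in at most one entry, then the rows of `a` and
the columns of `b` are those of one tableau. -/
theorem exists_tableau_of_injective (a b : Tableau lam n)
    (hinj : ∀ x y, a.rowOf x = a.rowOf y → b.colOf x = b.colOf y → x = y) :
    ∃ u : Tableau lam n, u.rowOf = a.rowOf ∧ u.colOf = b.colOf := by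
  classical
  have hle : ∀ i k, (Finset.univ.filter fun x => a.rowOf x = i ∧ b.colOf x < k).card
      ≤ min (lam.rowLen i) k := by
    intro i k
    refine le_min ?_ ?_
    · rw [← card_filter_rowOf a i]
      exact Finset.card_le_card fun x hx => by simp at hx ⊢; exact hx.1
    · rw [← Finset.card_range k]
      refine Finset.card_le_card_of_injOn b.colOf ?_ ?_
      · intro x hx; simp at hx ⊢; exact hx.2
      · intro x hx y hy hxy
        simp at hx hy
        exact hinj x y (hx.1.trans hy.1.symm) hxy
  -- Counts the entries in the first `k` columns of `b` by their row in `c`; `M` only has to exceed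
  -- all row indices. It is used for both `c = a` and `c = b`.
  have hsplit : ∀ (c : Tableau lam n) (k : ℕ), ∃ N, ∀ M, N ≤ M →
      (Finset.univ.filter fun x => b.colOf x < k).card =
      ∑ i ∈ Finset.range M, (Finset.univ.filter fun x => c.rowOf x = i ∧ b.colOf x < k).card := by
    intro c k
    refine ⟨Finset.univ.sup c.rowOf + 1, fun M hM => ?_⟩
    rw [Finset.card_eq_sum_card_fiberwise (f := c.rowOf) (t := Finset.range M)]
    · refine Finset.sum_congr rfl fun i _ => ?_
      rw [Finset.filter_filter]
      congr 1
      ext x; simp [and_comm]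
    · intro x _
      have : c.rowOf x ≤ Finset.univ.sup c.rowOf := Finset.le_sup (Finset.mem_univ x)
      simp; omega
  have heq : ∀ i k, (Finset.univ.filter fun x => a.rowOf x = i ∧ b.colOf x < k).card
      = min (lam.rowLen i) k := by
    intro i k
    obtain ⟨N₁, h₁⟩ := hsplit a k
    obtain ⟨N₂, h₂⟩ := hsplit b k
    -- For `c = b` the summands are the upper bounds from `hle`, for `c = a` they are bounded by
    -- them. Equal totals force equality in every row; the range is taken large enough to contain
    -- `i`.
    have e := (h₁ (N₁ + N₂ + i + 1) (by omega)).symm.trans (h₂ (N₁ + N₂ + i + 1) (by omega))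
    simp only [card_filter_rowOf_colOf_lt] at e
    exact (Finset.sum_eq_sum_iff_of_le fun i _ => hle i k).mp e i (by simp)
  have hmem : ∀ x, (a.rowOf x, b.colOf x) ∈ lam.cells := by
    intro x
    have hsub : (Finset.univ.filter fun y => a.rowOf y = a.rowOf x ∧
        b.colOf y < lam.rowLen (a.rowOf x)) ⊆ Finset.univ.filter fun y => a.rowOf y = a.rowOf x :=
      fun y hy => by simp at hy ⊢; exact hy.1
    -- With `k` the length of the row, the count fills the whole row, so each of its entries lies in
    -- a column of `b` that meets this row of the diagram.
    have := Finset.eq_of_subset_of_card_le hsub (by rw [card_filter_rowOf, heq, min_self])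
    have hx : x ∈ Finset.univ.filter fun y => a.rowOf y = a.rowOf x := by simp
    rw [← this] at hx
    simp only [Finset.mem_filter, Finset.mem_univ, true_and] at hx
    exact YoungDiagram.mem_iff_lt_rowLen.mpr hx
  let f : Fin n → {c : ℕ × ℕ // c ∈ lam.cells} := fun x => ⟨(a.rowOf x, b.colOf x), hmem x⟩
  have hf : Function.Injective f := fun x y hxy => by
    have := congrArg Subtype.val hxy
    exact hinj x y (Prod.ext_iff.mp this).1 (Prod.ext_iff.mp this).2
  have hbij : Function.Bijective f :=
    (Fintype.bijective_iff_injective_and_card f).mpr ⟨hf, Fintype.card_congr a.symm⟩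
  refine ⟨(Equiv.ofBijective f hbij).symm, ?_, ?_⟩ <;> rfl

/-- A sign-equivariant matrix between row tabloids and column tabloids is a multiple of the
incidence matrix. -/
theorem eq_mul_incidence (h : mu = lam.transpose) (u₀ : Tableau lam n)
    (X : Tabloid lam n → Tabloid mu n → ℤ)
    (hX : ∀ (g : Perm (Fin n)) s t, X (g • s) (g • t) = Perm.sign g * X s t)
    (s : Tabloid lam n) (t : Tabloid mu n) :
    X s t = X (Tabloid.mk u₀) (Tabloid.mk (u₀.tr h)) * incidence h u₀ s t := by
  obtain ⟨a, rfl⟩ := s.exists_mk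
  obtain ⟨b', rfl⟩ := t.exists_mk
  obtain ⟨b, rfl⟩ := (Tableau.trEquiv h).surjective b'
  change X (Tabloid.mk a) (Tabloid.mk (b.tr h)) = _ * incidence h u₀ _ (Tabloid.mk (b.tr h))
  by_cases hinj : ∀ x y, a.rowOf x = a.rowOf y → b.colOf x = b.colOf y → x = y
  · obtain ⟨u, hu₁, hu₂⟩ := exists_tableau_of_injective a b hinj
    have e₁ : Tabloid.mk a = Tabloid.mk u := Tabloid.mk_eq_mk.mpr hu₁.symm
    have e₂ : Tabloid.mk (b.tr h) = Tabloid.mk (u.tr h) := Tabloid.mk_eq_mk.mpr hu₂.symm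
    rw [e₁, e₂, incidence_mk]
    obtain ⟨g, rfl⟩ := u₀.exists_perm u
    rw [Tableau.tr_perm, ← Tabloid.smul_mk, ← Tabloid.smul_mk, hX, Tableau.sgn_perm,
      Tableau.sgn_self, mul_one, mul_comm]
  · push Not at hinj
    obtain ⟨x, y, h₁, h₂, hne⟩ := hinj
    have e₁ := Tabloid.swap_smul_mk a h₁
    have e₂ := Tabloid.swap_smul_mk (b.tr h) h₂
    -- The transposition of `x` and `y` fixes both tabloids and has sign -1, so the entry equals its
    -- own negative.
    have key : ∀ Y : Tabloid lam n → Tabloid mu n → ℤ,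
        (∀ (g : Perm (Fin n)) s t, Y (g • s) (g • t) = Perm.sign g * Y s t) →
        Y (Tabloid.mk a) (Tabloid.mk (b.tr h)) = 0 := by
      intro Y hY
      have := hY (Equiv.swap x y) (Tabloid.mk a) (Tabloid.mk (b.tr h))
      rw [e₁, e₂, Perm.sign_swap hne] at this
      simp at this
      omega
    rw [key X hX, key _ (incidence_smul h u₀), mul_zero]

end Tableaux

/-! ### Specht modules as images of the incidence maps, and the scalar n!/n_λ. -/

section IncidenceMap

variable {lam mu : YoungDiagram} {n : ℕ}

/-- The linear map `M^mu → M^lam` given by the incidence matrix of row and column tabloids. -/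
def incidenceMap (h : mu = lam.transpose) (u₀ : Tableau lam n) :
    TabloidModule mu n →ₗ[ℤ] TabloidModule lam n :=
  Finsupp.linearCombination ℤ fun t => Finsupp.equivFunOnFinite.symm fun s => incidence h u₀ s t

theorem incidenceMap_single_apply (h : mu = lam.transpose) (u₀ : Tableau lam n)
    (t : Tabloid mu n) (s : Tabloid lam n) :
    incidenceMap h u₀ (Finsupp.single t 1) s = incidence h u₀ s t := by
  simp [incidenceMap]

theorem incidenceMap_apply (h : mu = lam.transpose) (u₀ : Tableau lam n)
    (w : TabloidModule mu n) (s : Tabloid lam n) :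
    incidenceMap h u₀ w s = ∑ t, incidence h u₀ s t * w t := by
  rw [incidenceMap, Finsupp.linearCombination_apply, Finsupp.sum_fintype _ _ (by simp),
    Finsupp.finsetSum_apply]
  exact Finset.sum_congr rfl fun t _ => by simp [mul_comm]

theorem tabloidForm_apply (v w : TabloidModule lam n) :
    tabloidForm lam n v w = ∑ s, v s * w s := by
  rw [tabloidForm, Finsupp.linearCombination_apply, Finsupp.sum_fintype _ _ (by simp)]
  simp

theorem tabloidForm_comm (v w : TabloidModule lam n) :
    tabloidForm lam n v w = tabloidForm lam n w v := by
  simp only [tabloidForm_apply, mul_comm]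

theorem tabloidForm_single_left (s : Tabloid lam n) (w : TabloidModule lam n) :
    tabloidForm lam n (Finsupp.single s 1) w = w s := by
  simp [tabloidForm]

/-- The incidence maps of `lam` and `mu` have transposed matrices, hence are adjoint. -/
theorem tabloidForm_incidenceMap (h : mu = lam.transpose) (u₀ : Tableau lam n)
    (w : TabloidModule mu n) (v : TabloidModule lam n) :
    tabloidForm lam n v (incidenceMap h u₀ w)
      = tabloidForm mu n (incidenceMap (eq_transpose_symm h) (u₀.tr h) v) w := by
  simp only [tabloidForm_apply, incidenceMap_apply, incidence_tr, Finset.mul_sum,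
    Finset.sum_mul]
  rw [Finset.sum_comm]
  exact Finset.sum_congr rfl fun t _ => Finset.sum_congr rfl fun s _ => by ring

theorem tabloidRep_apply (g : Perm (Fin n)) (v : TabloidModule lam n) (s : Tabloid lam n) :
    tabloidRep lam n g v (g • s) = v s :=
  Finsupp.mapDomain_apply (MulAction.injective g) v s

theorem incidenceMap_tabloidRep (h : mu = lam.transpose) (u₀ : Tableau lam n) (g : Perm (Fin n))
    (w : TabloidModule mu n) :
    incidenceMap h u₀ (tabloidRep mu n g w)
      = (Perm.sign g : ℤ) • tabloidRep lam n g (incidenceMap h u₀ w) := by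
  ext s
  obtain ⟨s, rfl⟩ := MulAction.surjective g s
  rw [Finsupp.smul_apply, tabloidRep_apply, incidenceMap_apply, incidenceMap_apply,
    Finset.smul_sum]
  refine (Fintype.sum_equiv (MulAction.toPerm g) _ _ fun t => ?_).symm
  rw [MulAction.toPerm_apply, tabloidRep_apply, incidence_smul, smul_eq_mul, mul_assoc]

/-- The tableaux with the same column tabloid as `a` are exactly the `a.perm g` with `g` in the
column stabilizer, and the sign of `g` is the product of the signs of `a` and `a.perm g`. -/
theorem polytabloid_eq (h : mu = lam.transpose) (u₀ a : Tableau lam n) :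
    polytabloid a = u₀.sgn a • incidenceMap h u₀ (Finsupp.single (Tabloid.mk (a.tr h)) 1) := by
  classical
  ext s
  rw [Finsupp.smul_apply, incidenceMap_single_apply, polytabloid, Finsupp.finsetSum_apply]
  simp only [Finsupp.single_apply]
  by_cases hs : ∃ g : a.columnStabilizer, (g : Perm (Fin n)) • Tabloid.mk a = s
  · obtain ⟨g, rfl⟩ := hs
    have hcol : ∀ k : a.columnStabilizer,
        Tabloid.mk ((a.perm (k : Perm (Fin n))).tr h) = Tabloid.mk (a.tr h) := by
      intro k
      rw [Tabloid.mk_eq_mk, Tableau.rowOf_tr, Tableau.rowOf_tr]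
      exact funext fun x => k⁻¹.2 x
    rw [Finset.sum_eq_single g, if_pos rfl]
    · have := incidence_mk h u₀ (a.perm (g : Perm (Fin n)))
      rw [hcol] at this
      rw [Tabloid.smul_mk, this, Tableau.sgn_perm, smul_eq_mul, mul_left_comm,
        Tableau.sgn_mul_self, mul_one]
    · intro k _ hk
      refine if_neg fun hh => hk (Subtype.ext (a.perm_injective ?_))
      exact Tableau.eq_of_mk_eq h hh ((hcol k).trans (hcol g).symm)
    · simp
  · push Not at hs
    rw [Finset.sum_eq_zero fun g _ => if_neg (hs g), eq_comm, smul_eq_zero, or_iff_not_imp_right]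
    intro hne
    obtain ⟨u, hu, hut⟩ := incidence_ne_zero hne
    obtain ⟨g, rfl⟩ := a.exists_perm u
    have hg : g⁻¹ ∈ a.columnStabilizer := fun x => congrFun (Tabloid.mk_eq_mk.mp hut) x
    exact absurd hu (hs ⟨g, inv_mem_iff.mp hg⟩)

theorem spechtSub_eq_range (h : mu = lam.transpose) (u₀ : Tableau lam n) :
    (spechtSub lam n).toSubmodule = LinearMap.range (incidenceMap h u₀) := by
  change Submodule.span ℤ _ = _
  apply le_antisymm
  · rw [Submodule.span_le]
    rintro _ ⟨a, rfl⟩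
    rw [polytabloid_eq h u₀ a]
    exact Submodule.smul_mem _ _ ⟨_, rfl⟩
  · rw [LinearMap.range_eq_map, ← (Finsupp.basisSingleOne (R := ℤ)).span_eq, Submodule.map_span,
      Submodule.span_le]
    rintro _ ⟨_, ⟨t, rfl⟩, rfl⟩
    obtain ⟨b, rfl⟩ := t.exists_mk
    obtain ⟨a, rfl⟩ := (Tableau.trEquiv h).surjective b
    rw [Finsupp.coe_basisSingleOne, Tableau.trEquiv_apply]
    have := polytabloid_eq h u₀ a
    have e : incidenceMap h u₀ (Finsupp.single (Tabloid.mk (a.tr h)) 1)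
        = u₀.sgn a • polytabloid a := by
      rw [this, smul_smul, Tableau.sgn_mul_self, one_smul]
    rw [e]
    exact Submodule.smul_mem _ _ (Submodule.subset_span ⟨a, rfl⟩)

theorem incidenceMap_mem_specht (h : mu = lam.transpose) (u₀ : Tableau lam n)
    (w : TabloidModule mu n) : incidenceMap h u₀ w ∈ (spechtSub lam n).toSubmodule := by
  rw [spechtSub_eq_range h u₀]
  exact ⟨w, rfl⟩

theorem exists_incidenceMap_eq (h : mu = lam.transpose) (u₀ : Tableau lam n)
    (x : Specht lam n) : ∃ w, incidenceMap h u₀ w = x := by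
  obtain ⟨x, hx⟩ := x
  rwa [spechtSub_eq_range h u₀] at hx

/-- The composite of the two incidence maps acts on the Specht modules as one scalar. -/
theorem exists_scalar (h : mu = lam.transpose) (u₀ : Tableau lam n) :
    ∃ m : ℤ, (∀ w, incidenceMap h u₀ (incidenceMap (eq_transpose_symm h) (u₀.tr h)
        (incidenceMap h u₀ w)) = m • incidenceMap h u₀ w) ∧
      ∀ v, incidenceMap (eq_transpose_symm h) (u₀.tr h) (incidenceMap h u₀
        (incidenceMap (eq_transpose_symm h) (u₀.tr h) v))
          = m • incidenceMap (eq_transpose_symm h) (u₀.tr h) v := by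
  let T := incidenceMap h u₀
  let T' := incidenceMap (eq_transpose_symm h) (u₀.tr h)
  -- The matrix of T T' T. Three sign twists compose to one, so it is sign-equivariant and hence a
  -- multiple of T.
  let X : Tabloid lam n → Tabloid mu n → ℤ := fun s t => T (T' (T (Finsupp.single t 1))) s
  have hX : ∀ (g : Perm (Fin n)) s t, X (g • s) (g • t) = Perm.sign g * X s t := by
    intro g s t
    simp only [X, T, T']
    rw [← tabloidRep_single, incidenceMap_tabloidRep, map_zsmul, incidenceMap_tabloidRep, map_zsmul,
      map_zsmul, incidenceMap_tabloidRep, smul_smul, sign_mul_sign, one_smul, Finsupp.smul_apply,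
      tabloidRep_apply, smul_eq_mul]
  refine ⟨X (Tabloid.mk u₀) (Tabloid.mk (u₀.tr h)), ?_⟩
  have h₁ : ∀ w, T (T' (T w)) = X (Tabloid.mk u₀) (Tabloid.mk (u₀.tr h)) • T w := by
    intro w
    have : T ∘ₗ T' ∘ₗ T = X (Tabloid.mk u₀) (Tabloid.mk (u₀.tr h)) • T := by
      refine (Finsupp.basisSingleOne (R := ℤ)).ext fun t => ?_
      rw [Finsupp.coe_basisSingleOne]
      ext s
      rw [LinearMap.smul_apply, Finsupp.smul_apply, incidenceMap_single_apply, smul_eq_mul,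
        ← eq_mul_incidence h u₀ X hX]
      rfl
    exact LinearMap.congr_fun this w
  refine ⟨h₁, fun v => ?_⟩
  -- The second identity is the adjoint of the first.
  have hcoord : ∀ x t, T' x t = tabloidForm lam n x (T (Finsupp.single t 1)) := fun x t => by
    rw [← tabloidForm_single_left t, tabloidForm_comm, tabloidForm_incidenceMap]
  ext t
  rw [Finsupp.smul_apply]
  change T' (T (T' v)) t = _ • T' v t
  rw [hcoord, hcoord, tabloidForm_comm, tabloidForm_incidenceMap, tabloidForm_comm,
    ← tabloidForm_incidenceMap]
  have := congrArg (tabloidForm lam n v) (h₁ (Finsupp.single t 1))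
  rw [map_zsmul] at this
  exact this

/-- Each tableau contributes exactly one entry ±1, and there are n! tableaux. -/
theorem sum_incidence_mul_self (h : mu = lam.transpose) (u₀ : Tableau lam n) :
    ∑ s, ∑ t, incidence h u₀ s t * incidence h u₀ s t = n ! := by
  classical
  have key : ∀ s t, incidence h u₀ s t * incidence h u₀ s t =
      ∑ u : Tableau lam n, if Tabloid.mk u = s ∧ Tabloid.mk (u.tr h) = t then 1 else 0 := by
    intro s t
    by_cases hst : ∃ u, Tabloid.mk u = s ∧ Tabloid.mk (u.tr h) = t
    · obtain ⟨u, rfl, rfl⟩ := hst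
      rw [incidence_mk, Tableau.sgn_mul_self, Finset.sum_eq_single u, if_pos ⟨rfl, rfl⟩]
      · exact fun v _ hv => if_neg fun hh => hv (Tableau.eq_of_mk_eq h hh.1 hh.2)
      · simp
    · push Not at hst
      have : incidence h u₀ s t = 0 := by
        by_contra hne
        obtain ⟨u, hu, hut⟩ := incidence_ne_zero hne
        exact hst u hu hut
      rw [this, Finset.sum_eq_zero fun u _ => if_neg fun hu => hst u hu.1 hu.2, mul_zero]
  simp only [key]
  have hcard : Fintype.card (Tableau lam n) = n ! := by
    rw [Fintype.card_congr (Equiv.equivCongr u₀ (Equiv.refl (Fin n))), Fintype.card_perm,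
      Fintype.card_fin]
  rw [← hcard, Finset.sum_congr rfl fun s _ => Finset.sum_comm, Finset.sum_comm]
  simp [ite_and]

/-- T T' factors through the Specht lattice, on which it is multiplication by `m`; its trace is
therefore `m` times the rank. On M^λ the same trace is the sum of the squared matrix entries. -/
theorem scalar_mul_spechtRank (h : mu = lam.transpose) (u₀ : Tableau lam n) {m : ℤ}
    (hm : ∀ w, incidenceMap h u₀ (incidenceMap (eq_transpose_symm h) (u₀.tr h)
        (incidenceMap h u₀ w)) = m • incidenceMap h u₀ w) :
    m * spechtRank lam n = n ! := by
  classical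
  let P := incidenceMap h u₀ ∘ₗ incidenceMap (eq_transpose_symm h) (u₀.tr h)
  let f : TabloidModule lam n →ₗ[ℤ] Specht lam n :=
    P.codRestrict _ fun v => incidenceMap_mem_specht h u₀ _
  have h₁ : (spechtSub lam n).toSubmodule.subtype ∘ₗ f = P := by ext; rfl
  have h₂ : f ∘ₗ (spechtSub lam n).toSubmodule.subtype = m • LinearMap.id := by
    ext1 x
    obtain ⟨w, hw⟩ := exists_incidenceMap_eq h u₀ x
    refine Subtype.ext ?_
    change incidenceMap h u₀ (incidenceMap _ _ (x : TabloidModule lam n))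
      = m • (x : TabloidModule lam n)
    rw [← hw, hm]
  have h₃ := LinearMap.trace_comp_comm' (R := ℤ) f (spechtSub lam n).toSubmodule.subtype
  rw [h₁, h₂, map_smul, LinearMap.trace_id, smul_eq_mul] at h₃
  rw [spechtRank, ← h₃, ← sum_incidence_mul_self h u₀,
    LinearMap.trace_eq_matrix_trace ℤ Finsupp.basisSingleOne, Matrix.trace]
  refine Finset.sum_congr rfl fun s _ => ?_
  rw [Matrix.diag_apply, LinearMap.toMatrix_apply, Finsupp.coe_basisSingleOne,
    Finsupp.basisSingleOne_repr, LinearEquiv.refl_apply, LinearMap.comp_apply, incidenceMap_apply]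
  refine Finset.sum_congr rfl fun t _ => ?_
  rw [incidenceMap_single_apply, incidence_tr]

end IncidenceMap

/-! ### Purity of the Specht lattice, by way of standard tableaux. -/

section Purity

variable {lam mu : YoungDiagram} {n : ℕ}

/-- The entries increase down the columns. -/
def Tableau.IsColumnIncreasing (t : Tableau lam n) : Prop :=
  ∀ x y, t.colOf x = t.colOf y → t.rowOf x < t.rowOf y → x < y

/-- The entries increase along the rows. -/
def Tableau.IsRowIncreasing (t : Tableau lam n) : Prop :=
  ∀ x y, t.rowOf x = t.rowOf y → t.colOf x < t.colOf y → x < y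

/-- A standard tableau. -/
def Tableau.IsStandard (t : Tableau lam n) : Prop :=
  t.IsColumnIncreasing ∧ t.IsRowIncreasing

/-- The sum of the entries weighted by their row indices. -/
def Tableau.rowWeight (t : Tableau lam n) : ℤ := ∑ x : Fin n, (x : ℤ) * t.rowOf x

/-- The sum of the entries weighted by their column indices. -/
def Tableau.colWeight (t : Tableau lam n) : ℤ := ∑ x : Fin n, (x : ℤ) * t.colOf x

theorem Tableau.rowWeight_congr {a b : Tableau lam n} (h : a.rowOf = b.rowOf) :
    a.rowWeight = b.rowWeight := by
  simp only [rowWeight, h]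

theorem Tableau.colWeight_congr {a b : Tableau lam n} (h : a.colOf = b.colOf) :
    a.colWeight = b.colWeight := by
  simp only [colWeight, h]

/-- Swapping two entries of a column that are in the wrong order raises the weight by the product of
their difference and the difference of their rows. -/
theorem Tableau.exists_rowWeight_lt (t : Tableau lam n) (ht : ¬ t.IsColumnIncreasing) :
    ∃ u : Tableau lam n, u.colOf = t.colOf ∧ t.rowWeight < u.rowWeight := by
  unfold IsColumnIncreasing at ht
  push Not at ht
  obtain ⟨x, y, hc, hr, hle⟩ := ht
  have hne : x ≠ y := by rintro rfl; exact lt_irrefl _ hr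
  have hlt : y < x := lt_of_le_of_ne hle hne.symm
  refine ⟨t.perm (Equiv.swap x y), ?_, ?_⟩
  · have := Tabloid.swap_smul_mk (t.tr (mu := lam.transpose) rfl) hc
    exact Tabloid.mk_eq_mk.mp this
  · rw [← sub_pos, rowWeight, rowWeight, ← Finset.sum_sub_distrib]
    simp only [rowOf_perm, Equiv.swap_inv]
    rw [Fintype.sum_eq_add x y hne]
    · rw [Equiv.swap_apply_left, Equiv.swap_apply_right]
      have h₁ : (y : ℤ) < (x : ℤ) := by exact_mod_cast hlt
      have h₂ : (t.rowOf x : ℤ) < t.rowOf y := by exact_mod_cast hr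
      nlinarith [mul_pos (sub_pos.mpr h₁) (sub_pos.mpr h₂)]
    · rintro z ⟨hx, hy⟩
      rw [Equiv.swap_apply_of_ne_of_ne hx hy, sub_self]

theorem Tableau.exists_max_rowWeight (t : Tableau lam n) :
    ∃ u : Tableau lam n, u.colOf = t.colOf ∧
      ∀ v : Tableau lam n, v.colOf = t.colOf → v.rowWeight ≤ u.rowWeight := by
  classical
  obtain ⟨u, hu, hmax⟩ := Finset.exists_max_image
    (Finset.univ.filter fun u : Tableau lam n => u.colOf = t.colOf) rowWeight ⟨t, by simp⟩
  exact ⟨u, by simpa using hu, fun v hv => hmax v (by simpa using hv)⟩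

theorem Tableau.isColumnIncreasing_of_max {t : Tableau lam n}
    (ht : ∀ v : Tableau lam n, v.colOf = t.colOf → v.rowWeight ≤ t.rowWeight) :
    t.IsColumnIncreasing := by
  by_contra hn
  obtain ⟨u, hu, hlt⟩ := t.exists_rowWeight_lt hn
  exact absurd (ht u hu) (not_le.mpr hlt)

/-- In an increasing column, the entries in the rows above are precisely the smaller ones. Thus the
columns as sets determine the tableau. -/
theorem Tableau.IsColumnIncreasing.rowOf_eq {t : Tableau lam n} (ht : t.IsColumnIncreasing)
    (x : Fin n) :
    t.rowOf x = (Finset.univ.filter fun y => t.colOf y = t.colOf x ∧ y < x).card := by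
  have h₁ := card_filter_rowOf_colOf_lt (t.tr (mu := lam.transpose) rfl) (t.colOf x) (t.rowOf x)
  rw [YoungDiagram.rowLen_transpose, min_eq_right (t.rowOf_lt x).le] at h₁
  rw [← h₁]
  congr 1
  ext y
  rw [Finset.mem_filter_univ, Finset.mem_filter_univ]
  refine and_congr_right fun hc => ⟨fun hr => ht y x hc hr, fun hlt => ?_⟩
  by_contra hn
  rcases (not_lt.mp hn).eq_or_lt with he | hgt
  · exact hlt.ne' (t.entry_ext he hc.symm)
  · exact lt_asymm hlt (ht x y hc.symm hgt)

theorem Tableau.IsColumnIncreasing.eq {t u : Tableau lam n} (ht : t.IsColumnIncreasing)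
    (hu : u.IsColumnIncreasing) (h : t.colOf = u.colOf) : t = u := by
  refine ext_rowOf_colOf (funext fun x => ?_) h
  rw [ht.rowOf_eq, hu.rowOf_eq, h]

theorem Tableau.IsRowIncreasing.eq {t u : Tableau lam n} (ht : t.IsRowIncreasing)
    (hu : u.IsRowIncreasing) (h : t.rowOf = u.rowOf) : t = u := by
  have ht' : (t.tr (mu := lam.transpose) rfl).IsColumnIncreasing := ht
  have hu' : (u.tr (mu := lam.transpose) rfl).IsColumnIncreasing := hu
  exact (trEquiv rfl).injective (ht'.eq hu' h)

/-- A maximizer of the row weight is column increasing, and there is only one such filling of given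
columns. This yields the triangularity of the standard polytabloids. -/
theorem Tableau.IsColumnIncreasing.rowWeight_lt {t u : Tableau lam n} (ht : t.IsColumnIncreasing)
    (h : u.colOf = t.colOf) (hne : u ≠ t) : u.rowWeight < t.rowWeight := by
  obtain ⟨m, hm, hmax⟩ := t.exists_max_rowWeight
  obtain rfl : m = t :=
    (isColumnIncreasing_of_max fun v hv => hmax v (hv.trans hm)).eq ht hm
  refine lt_of_le_of_ne (hmax u h) fun he => hne ?_
  exact (isColumnIncreasing_of_max fun v hv => he ▸ hmax v (hv.trans h)).eq ht h

/-! ### Garnir relations -/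

theorem mem_of_fix_compl {Z : Finset (Fin n)} {σ : Perm (Fin n)} (hσ : ∀ x, x ∉ Z → σ x = x)
    {z : Fin n} (hz : z ∈ Z) : σ⁻¹ z ∈ Z := by
  by_contra hn
  have := hσ _ hn
  rw [← Perm.mul_apply, mul_inv_cancel, Perm.one_apply] at this
  exact hn (this ▸ hz)

open Classical in
-- No signs appear because the incidence matrix absorbs them. Look at the coefficient at a row
-- tabloid `{a}`. If two elements of `Z` share a row of `a`, their transposition cancels the terms
-- in pairs. Otherwise a nonzero term would place the elements of `Z` in distinct rows and in
-- columns from `j` on, and these offer only `lam.colLen j` rows.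
theorem garnir_relation (h : mu = lam.transpose) (u₀ t : Tableau lam n) (Z : Finset (Fin n))
    (j : ℕ) (hZ : ∀ z ∈ Z, j ≤ t.colOf z) (hcard : lam.colLen j < Z.card) :
    ∑ σ : Perm (Fin n) with ∀ x, x ∉ Z → σ x = x,
      incidenceMap h u₀ (Finsupp.single (Tabloid.mk ((t.perm σ).tr h)) 1) = 0 := by
  ext s
  obtain ⟨a, rfl⟩ := s.exists_mk
  rw [Finsupp.finsetSum_apply, Finsupp.zero_apply]
  simp only [incidenceMap_single_apply]
  by_cases hinj : ∀ x ∈ Z, ∀ y ∈ Z, a.rowOf x = a.rowOf y → x = y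
  · refine Finset.sum_eq_zero fun σ hσ => ?_
    rw [Finset.mem_filter] at hσ
    by_contra hne
    obtain ⟨u, hu₁, hu₂⟩ := incidence_ne_zero hne
    rw [Tabloid.mk_eq_mk] at hu₁ hu₂
    refine absurd hcard (not_lt.mpr ?_)
    rw [← Finset.card_range (lam.colLen j)]
    refine Finset.card_le_card_of_injOn u.rowOf ?_ ?_
    · intro z hz
      rw [Finset.mem_coe] at hz
      rw [Finset.coe_range, Set.mem_Iio]
      refine (u.rowOf_lt z).trans_le (YoungDiagram.colLen_anti _ _ _ ?_)
      have e : u.colOf z = t.colOf (σ⁻¹ z) := congrFun hu₂ z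
      rw [e]
      exact hZ _ (mem_of_fix_compl hσ.2 hz)
    · intro x hx y hy hxy
      rw [hu₁] at hxy
      exact hinj x hx y hy hxy
  · push Not at hinj
    obtain ⟨x, hx, y, hy, hxy, hne⟩ := hinj
    have hneg : ∀ σ : Perm (Fin n), incidence h u₀ (Tabloid.mk a)
        (Tabloid.mk ((t.perm (Equiv.swap x y * σ)).tr h))
          = - incidence h u₀ (Tabloid.mk a) (Tabloid.mk ((t.perm σ).tr h)) := by
      intro σ
      rw [Tableau.perm_mul, Tableau.tr_perm, ← Tabloid.smul_mk]
      nth_rewrite 1 [← Tabloid.swap_smul_mk a hxy]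
      rw [incidence_smul, Perm.sign_swap hne]
      simp
    have hsum := Finset.sum_equiv (Equiv.mulLeft (Equiv.swap x y))
      (s := Finset.univ.filter fun σ : Perm (Fin n) => ∀ x, x ∉ Z → σ x = x)
      (t := Finset.univ.filter fun σ : Perm (Fin n) => ∀ x, x ∉ Z → σ x = x)
      (f := fun σ => - incidence h u₀ (Tabloid.mk a) (Tabloid.mk ((t.perm σ).tr h)))
      (g := fun σ => incidence h u₀ (Tabloid.mk a) (Tabloid.mk ((t.perm σ).tr h))) ?_ ?_
    · rw [Finset.sum_neg_distrib] at hsum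
      omega
    · intro σ
      simp only [Finset.mem_filter, Finset.mem_univ, true_and, Equiv.coe_mulLeft, Perm.mul_apply]
      refine forall₂_congr fun z hz => ?_
      have hs : Equiv.swap x y z = z := Equiv.swap_apply_of_ne_of_ne
        (fun e => hz (e ▸ hx)) (fun e => hz (e ▸ hy))
      exact ⟨fun e => by rw [e, hs], fun e => (Equiv.swap x y).injective (e.trans hs.symm)⟩
    · intro σ _
      exact (hneg σ).symm

theorem sum_lt_sum_of_separated {A Y : Finset (Fin n)} (hcard : A.card = Y.card) (hne : A ≠ Y)
    {y x : Fin n} (hyx : y < x) (hY : ∀ z ∈ Y, z ≤ y) (hA : ∀ z ∈ A, z ∉ Y → x ≤ z) :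
    ∑ z ∈ Y, (z : ℤ) < ∑ z ∈ A, (z : ℤ) := by
  rw [← Finset.sum_sdiff_lt_sum_sdiff]
  have hc : (A \ Y).card = (Y \ A).card := Finset.card_sdiff_comm hcard
  have hpos : 0 < (A \ Y).card := by
    rw [Finset.card_pos, Finset.sdiff_nonempty]
    exact fun hsub => hne (Finset.eq_of_subset_of_card_le hsub hcard.ge)
  have h₁ : ∑ z ∈ Y \ A, (z : ℤ) ≤ (Y \ A).card • (y : ℤ) :=
    Finset.sum_le_card_nsmul _ _ _ fun z hz => by
      exact_mod_cast hY z (Finset.mem_sdiff.mp hz).1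
  have h₂ : (A \ Y).card • (x : ℤ) ≤ ∑ z ∈ A \ Y, (z : ℤ) :=
    Finset.card_nsmul_le_sum _ _ _ fun z hz => by
      rw [Finset.mem_sdiff] at hz
      exact_mod_cast hA z hz.1 hz.2
  refine h₁.trans_lt (lt_of_lt_of_le ?_ h₂)
  rw [← hc]
  have : (y : ℤ) < (x : ℤ) := by exact_mod_cast hyx
  exact smul_lt_smul_of_pos_left this hpos

theorem Tableau.colWeight_perm (t : Tableau lam n) (σ : Perm (Fin n)) :
    (t.perm σ).colWeight = ∑ x : Fin n, ((σ x : Fin n) : ℤ) * t.colOf x := by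
  rw [colWeight]
  refine (Fintype.sum_equiv σ _ _ fun x => ?_).symm
  rw [colOf_perm, ← Perm.mul_apply, inv_mul_cancel, Perm.one_apply]

theorem Tableau.colWeight_lt_perm (t : Tableau lam n) {X Y : Finset (Fin n)} {j k : ℕ}
    (hjk : j < k) (hX : ∀ z ∈ X, t.colOf z = j) (hY : ∀ z ∈ Y, t.colOf z = k)
    {y x : Fin n} (hyx : y < x) (hYy : ∀ z ∈ Y, z ≤ y) (hXx : ∀ z ∈ X, x ≤ z)
    {σ : Perm (Fin n)} (hσ : ∀ z, z ∉ X ∪ Y → σ z = z) (hne : Y.image σ ≠ Y) :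
    t.colWeight < (t.perm σ).colWeight := by
  classical
  -- The displacements sum to zero, so column indices may be shifted by `j`; then `X` drops out and
  -- only the change of the entry sum in column `k` remains.
  have hsum : ∑ z : Fin n, (((σ z : Fin n) : ℤ) - z) = 0 := by
    rw [Finset.sum_sub_distrib, Equiv.sum_comp σ fun z => (z : ℤ), sub_self]
  have e₁ : (t.perm σ).colWeight - t.colWeight
      = ∑ z : Fin n, (((σ z : Fin n) : ℤ) - z) * ((t.colOf z : ℤ) - j) := by
    rw [colWeight_perm, colWeight, ← Finset.sum_sub_distrib]
    simp only [mul_sub, sub_mul, Finset.sum_sub_distrib, ← Finset.sum_mul] at hsum ⊢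
    have : (∑ z : Fin n, ((σ z : Fin n) : ℤ)) = ∑ z : Fin n, (z : ℤ) := sub_eq_zero.mp hsum
    rw [this]; ring
  have e₂ : ∑ z : Fin n, (((σ z : Fin n) : ℤ) - z) * ((t.colOf z : ℤ) - j)
      = ∑ z ∈ Y, (((σ z : Fin n) : ℤ) - z) * ((k : ℤ) - j) := by
    rw [← Finset.sum_subset (Finset.subset_univ Y)]
    · exact Finset.sum_congr rfl fun z hz => by rw [hY z hz]
    · intro z _ hz
      by_cases hzX : z ∈ X
      · rw [hX z hzX, sub_self, mul_zero]
      · rw [hσ z (by simp [hz, hzX]), sub_self, zero_mul]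
  rw [← sub_pos, e₁, e₂, ← Finset.sum_mul, Finset.sum_sub_distrib]
  refine mul_pos (sub_pos.mpr ?_) (by rw [sub_pos]; exact_mod_cast hjk)
  rw [← Finset.sum_image (s := Y) (g := σ) (f := fun z : Fin n => (z : ℤ)) σ.injective.injOn]
  refine sum_lt_sum_of_separated (Finset.card_image_of_injective _ σ.injective) hne hyx hYy ?_
  intro z hz hzY
  obtain ⟨w, hw, rfl⟩ := Finset.mem_image.mp hz
  have : σ w ∈ X ∪ Y := by
    by_contra hn
    have h' := σ.injective (hσ _ hn)
    exact hn (h'.symm ▸ Finset.mem_union_right _ hw)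
  rcases Finset.mem_union.mp this with h' | h'
  · exact hXx _ h'
  · exact absurd h' hzY

/-! ### Standard polytabloids -/

/-- The elements of a module that have a nonzero multiple in a given submodule. -/
def saturation {M : Type*} [AddCommGroup M] (W : Submodule ℤ M) : Submodule ℤ M :=
  (Submodule.torsion ℤ (M ⧸ W)).comap W.mkQ

theorem mem_saturation {M : Type*} [AddCommGroup M] {W : Submodule ℤ M} {v : M} :
    v ∈ saturation W ↔ ∃ k : ℤ, k ≠ 0 ∧ k • v ∈ W := by
  rw [saturation, Submodule.mem_comap, Submodule.mem_torsion_iff]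
  constructor
  · rintro ⟨k, hk⟩
    exact ⟨k, nonZeroDivisors.coe_ne_zero k, (Submodule.Quotient.mk_eq_zero W).mp hk⟩
  · rintro ⟨k, hk, hv⟩
    exact ⟨⟨k, mem_nonZeroDivisors_of_ne_zero hk⟩, (Submodule.Quotient.mk_eq_zero W).mpr hv⟩

theorem le_saturation {M : Type*} [AddCommGroup M] (W : Submodule ℤ M) : W ≤ saturation W :=
  fun v hv => mem_saturation.mpr ⟨1, one_ne_zero, by rwa [one_smul]⟩

theorem mem_saturation_of_smul {M : Type*} [AddCommGroup M] {W : Submodule ℤ M} {k : ℤ}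
    (hk : k ≠ 0) {v : M} (hv : k • v ∈ saturation W) : v ∈ saturation W := by
  obtain ⟨l, hl, hlv⟩ := mem_saturation.mp hv
  exact mem_saturation.mpr ⟨l * k, mul_ne_zero hl hk, by rwa [mul_smul]⟩

/-- The span of the standard polytabloids. -/
def standardSpan (h : mu = lam.transpose) (u₀ : Tableau lam n) :
    Submodule ℤ (TabloidModule lam n) :=
  Submodule.span ℤ (Set.range fun u : {u : Tableau lam n // u.IsStandard} =>
    incidenceMap h u₀ (Finsupp.single (Tabloid.mk (u.1.tr h)) 1))

/-- If r is the common row, the lower part of the left column has `lam.colLen (t.colOf x)` - r cells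
and the upper part of the right column has r + 1, one too many in total. -/
theorem card_garnir (t : Tableau lam n) (x y : Fin n) (hr : t.rowOf x = t.rowOf y)
    (hc : t.colOf x < t.colOf y) :
    lam.colLen (t.colOf x) <
      ((Finset.univ.filter fun z => t.colOf z = t.colOf x ∧ t.rowOf x ≤ t.rowOf z) ∪
        Finset.univ.filter fun z => t.colOf z = t.colOf y ∧ t.rowOf z ≤ t.rowOf x).card := by
  classical
  rw [Finset.card_union_of_disjoint]
  · have h₁ : (Finset.Ico (t.rowOf x) (lam.colLen (t.colOf x))).card ≤
        (Finset.univ.filter fun z => t.colOf z = t.colOf x ∧ t.rowOf x ≤ t.rowOf z).card := by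
      refine Finset.card_le_card_of_surjOn t.rowOf fun i hi => ?_
      rw [Finset.mem_coe, Finset.mem_Ico] at hi
      obtain ⟨z, hz₁, hz₂⟩ := t.exists_entry (YoungDiagram.mem_iff_lt_colLen.mpr hi.2)
      exact ⟨z, by simp [hz₁, hz₂, hi.1], hz₁⟩
    have h₂ : (Finset.range (t.rowOf x + 1)).card ≤
        (Finset.univ.filter fun z => t.colOf z = t.colOf y ∧ t.rowOf z ≤ t.rowOf x).card := by
      refine Finset.card_le_card_of_surjOn t.rowOf fun i hi => ?_
      rw [Finset.mem_coe, Finset.mem_range] at hi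
      have := t.rowOf_lt y
      obtain ⟨z, hz₁, hz₂⟩ := t.exists_entry
        (YoungDiagram.mem_iff_lt_colLen.mpr (show i < lam.colLen (t.colOf y) by omega))
      exact ⟨z, by simp [hz₁, hz₂]; omega, hz₁⟩
    rw [Nat.card_Ico] at h₁
    rw [Finset.card_range] at h₂
    have := t.rowOf_lt x
    omega
  · rw [Finset.disjoint_filter]
    intro z _ h₁ h₂
    omega

/-- Straightening, by induction towards larger column weight. The Garnir sum runs over a full
symmetric group instead of coset representatives, so it expresses only a nonzero multiple of the
polytabloid; this is why the saturation occurs. -/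
theorem single_mem_saturation (h : mu = lam.transpose) (u₀ t : Tableau lam n) :
    incidenceMap h u₀ (Finsupp.single (Tabloid.mk (t.tr h)) 1)
      ∈ saturation (standardSpan h u₀) := by
  classical
  have hwf : WellFounded fun a b : Tableau lam n => b.colWeight < a.colWeight :=
    Finite.wellFounded_of_trans_of_irrefl (r := fun a b : Tableau lam n => b.colWeight < a.colWeight)
  induction t using hwf.induction with
  | _ t ih =>
  -- Only the column tabloid of `t` matters, so its columns may be sorted.
  obtain ⟨w, hw, hmax⟩ := t.exists_max_rowWeight
  have hinc : w.IsColumnIncreasing :=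
    Tableau.isColumnIncreasing_of_max fun v hv => hmax v (hv.trans hw)
  have hwt : Tabloid.mk (w.tr h) = Tabloid.mk (t.tr h) := Tabloid.mk_eq_mk.mpr hw
  rw [← hwt]
  by_cases hrow : w.IsRowIncreasing
  · exact le_saturation _ (Submodule.subset_span ⟨⟨w, hinc, hrow⟩, rfl⟩)
  unfold Tableau.IsRowIncreasing at hrow
  push Not at hrow
  obtain ⟨x, y, hr, hc, hle⟩ := hrow
  have hyx : y < x := lt_of_le_of_ne hle fun e => by rw [e] at hc; exact lt_irrefl _ hc
  let X := Finset.univ.filter fun z => w.colOf z = w.colOf x ∧ w.rowOf x ≤ w.rowOf z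
  let Y := Finset.univ.filter fun z => w.colOf z = w.colOf y ∧ w.rowOf z ≤ w.rowOf x
  have hX : ∀ z ∈ X, w.colOf z = w.colOf x ∧ w.rowOf x ≤ w.rowOf z := fun z hz => by
    simpa [X] using hz
  have hY : ∀ z ∈ Y, w.colOf z = w.colOf y ∧ w.rowOf z ≤ w.rowOf x := fun z hz => by
    simpa [Y] using hz
  have hXx : ∀ z ∈ X, x ≤ z := fun z hz => by
    rcases (hX z hz).2.eq_or_lt with he | hlt
    · exact (w.entry_ext he (hX z hz).1.symm).le
    · exact (hinc x z (hX z hz).1.symm hlt).le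
  have hYy : ∀ z ∈ Y, z ≤ y := fun z hz => by
    rcases (hr ▸ (hY z hz).2).eq_or_lt with he | hlt
    · exact (w.entry_ext he (hY z hz).1).le
    · exact (hinc z y (hY z hz).1 hlt).le
  have hg := garnir_relation h u₀ w (X ∪ Y) (w.colOf x) (fun z hz => by
    rcases Finset.mem_union.mp hz with hz | hz
    · exact (hX z hz).1.ge
    · exact (hY z hz).1 ▸ hc.le) (card_garnir w x y hr hc)
  -- The permutations preserving `Y` leave the column tabloid unchanged. All others move larger
  -- entries to the right, since every element of `Y` is smaller than every element of `X`, and so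
  -- they raise the column weight.
  rw [← Finset.sum_filter_add_sum_filter_not _ fun σ : Perm (Fin n) => Y.image σ = Y] at hg
  have hstab : ∀ σ ∈ (Finset.univ.filter fun σ : Perm (Fin n) =>
      ∀ z, z ∉ X ∪ Y → σ z = z).filter (fun σ : Perm (Fin n) => Y.image σ = Y),
      incidenceMap h u₀ (Finsupp.single (Tabloid.mk ((w.perm σ).tr h)) 1)
        = incidenceMap h u₀ (Finsupp.single (Tabloid.mk (w.tr h)) 1) := by
    intro σ hσ
    rw [Finset.mem_filter, Finset.mem_filter] at hσ
    obtain ⟨⟨-, hσ⟩, hσY⟩ := hσ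
    have hcol : ∀ z, w.colOf (σ z) = w.colOf z := by
      intro z
      by_cases hzY : z ∈ Y
      · have : σ z ∈ Y := hσY ▸ Finset.mem_image_of_mem σ hzY
        rw [(hY _ this).1, (hY _ hzY).1]
      by_cases hzX : z ∈ X
      · have h₁ : σ z ∉ Y := fun h' => by
          rw [← hσY] at h'
          obtain ⟨z', hz', he⟩ := Finset.mem_image.mp h'
          exact hzY (σ.injective he ▸ hz')
        have h₂ : σ z ∈ X ∪ Y := by
          by_contra hn
          have h' := σ.injective (hσ _ hn)
          exact hn (h'.symm ▸ Finset.mem_union_left _ hzX)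
        have h₃ : σ z ∈ X := (Finset.mem_union.mp h₂).resolve_right h₁
        rw [(hX _ h₃).1, (hX _ hzX).1]
      · rw [hσ z (by simp only [Finset.mem_union]; tauto)]
    have : Tabloid.mk ((w.perm σ).tr h) = Tabloid.mk (w.tr h) := by
      rw [Tabloid.mk_eq_mk, Tableau.rowOf_tr, Tableau.rowOf_tr]
      ext z
      have := hcol (σ⁻¹ z)
      rw [← Perm.mul_apply, mul_inv_cancel, Perm.one_apply] at this
      rw [Tableau.colOf_perm, this]
    rw [this]
  rw [Finset.sum_congr rfl hstab, Finset.sum_const, add_eq_zero_iff_eq_neg, ← natCast_zsmul] at hg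
  refine mem_saturation_of_smul (Nat.cast_ne_zero.mpr ?_) (hg ▸ neg_mem (sum_mem fun σ hσ => ?_))
  · exact Finset.card_ne_zero_of_mem (a := 1) (by simp)
  · rw [Finset.mem_filter, Finset.mem_filter] at hσ
    refine ih _ ?_
    rw [← Tableau.colWeight_congr hw]
    exact w.colWeight_lt_perm hc (fun z hz => (hX z hz).1) (fun z hz => (hY z hz).1) hyx hYy hXx
      hσ.1.2 hσ.2

/-- The evaluation of standard polytabloids at standard row tabloids is triangular with diagonal ±1
with respect to the row weight. Divisibility of the coefficients by `k` therefore descends from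
larger to smaller row weight. -/
theorem saturation_standardSpan (h : mu = lam.transpose) (u₀ : Tableau lam n) :
    saturation (standardSpan h u₀) ≤ standardSpan h u₀ := by
  classical
  intro v hv
  obtain ⟨k, hk, hkv⟩ := mem_saturation.mp hv
  obtain ⟨c, hc⟩ := (Submodule.mem_span_range_iff_exists_fun ℤ).mp hkv
  have hwf : WellFounded fun a b : {u : Tableau lam n // u.IsStandard} =>
      b.1.rowWeight < a.1.rowWeight :=
    Finite.wellFounded_of_trans_of_irrefl
      (r := fun a b : {u : Tableau lam n // u.IsStandard} => b.1.rowWeight < a.1.rowWeight)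
  have hdvd : ∀ u, k ∣ c u := by
    intro u
    induction u using hwf.induction with
    | _ u ih =>
    have hev := DFunLike.congr_fun hc (Tabloid.mk u.1)
    rw [Finsupp.finsetSum_apply, 
      ← Finset.add_sum_erase _ _ (Finset.mem_univ u)] at hev
    simp only [Finsupp.smul_apply, incidenceMap_single_apply, incidence_mk, smul_eq_mul] at hev
    have hrest : k ∣ ∑ u' ∈ Finset.univ.erase u,
        c u' * incidence h u₀ (Tabloid.mk u.1) (Tabloid.mk (u'.1.tr h)) := by
      refine Finset.dvd_sum fun u' hu' => ?_
      by_cases hz : incidence h u₀ (Tabloid.mk u.1) (Tabloid.mk (u'.1.tr h)) = 0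
      · rw [hz, mul_zero]; exact dvd_zero _
      obtain ⟨w, hw₁, hw₂⟩ := incidence_ne_zero hz
      rw [Tabloid.mk_eq_mk] at hw₁ hw₂
      refine Dvd.dvd.mul_right (ih u' ?_) _
      -- The tableau `w` has the rows of `u` and the columns of `u'`. Either its row weight is below
      -- that of `u'`, or it is `u'` itself, which then has the rows of `u` and so equals `u`.
      rw [← Tableau.rowWeight_congr hw₁]
      refine u'.2.1.rowWeight_lt hw₂ ?_
      rintro rfl
      have : u' = u := Subtype.ext (u'.2.2.eq u.2.2 hw₁)
      simp [this] at hu'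
    have h₁ : k ∣ c u * u₀.sgn u.1 :=
      (Int.dvd_iff_dvd_of_dvd_add (hev ▸ dvd_mul_right k _)).mpr hrest
    have h₂ := Dvd.dvd.mul_right h₁ (u₀.sgn u.1)
    rwa [mul_assoc, Tableau.sgn_mul_self, mul_one] at h₂
  choose d hd using hdvd
  refine (Submodule.mem_span_range_iff_exists_fun ℤ).mpr ⟨d, ?_⟩
  refine smul_right_injective _ hk ?_
  simp only [← hc, Finset.smul_sum, smul_smul, hd]

/-- The Specht lattice is a pure sublattice of `M^lam`. -/
theorem specht_pure (h : mu = lam.transpose) (u₀ : Tableau lam n) {k : ℤ} (hk : k ≠ 0)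
    {v : TabloidModule lam n} (hv : k • v ∈ (spechtSub lam n).toSubmodule) :
    v ∈ (spechtSub lam n).toSubmodule := by
  -- Specht lattice, standard span and its saturation contain one another cyclically, hence
  -- coincide.
  have h₁ : LinearMap.range (incidenceMap h u₀) ≤ saturation (standardSpan h u₀) := by
    rw [LinearMap.range_eq_map, ← (Finsupp.basisSingleOne (R := ℤ)).span_eq, Submodule.map_span,
      Submodule.span_le]
    rintro _ ⟨_, ⟨t, rfl⟩, rfl⟩
    obtain ⟨b, rfl⟩ := t.exists_mk
    obtain ⟨a, rfl⟩ := (Tableau.trEquiv h).surjective b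
    rw [Finsupp.coe_basisSingleOne, Tableau.trEquiv_apply]
    exact single_mem_saturation h u₀ a
  have h₂ : standardSpan h u₀ ≤ LinearMap.range (incidenceMap h u₀) := by
    rw [standardSpan, Submodule.span_le]
    rintro _ ⟨u, rfl⟩
    exact ⟨_, rfl⟩
  rw [spechtSub_eq_range h u₀] at hv ⊢
  exact h₂ (saturation_standardSpan h u₀ (mem_saturation_of_smul hk (h₁ hv)))

end Purity

/-! ### The dual of S^λ as the Specht lattice of the transposed diagram. -/

section Duality

variable {lam mu : YoungDiagram} {n : ℕ}

theorem tabloidForm_surjective : Function.Surjective (tabloidForm lam n) := by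
  classical
  intro f
  refine ⟨Finsupp.equivFunOnFinite.symm fun s => f (Finsupp.single s 1), ?_⟩
  refine (Finsupp.basisSingleOne (R := ℤ)).ext fun s => ?_
  rw [Finsupp.coe_basisSingleOne, tabloidForm_comm, tabloidForm_single_left]
  rfl

/-- The quotient by a pure sublattice is finitely generated and torsion-free, hence free. So `W` is
a direct summand, and functionals extend along the projection. -/
theorem dualRestrict_surjective_of_pure {M : Type*} [AddCommGroup M] [Module.Finite ℤ M]
    (W : Submodule ℤ M) (hW : ∀ (k : ℤ) (v : M), k ≠ 0 → k • v ∈ W → v ∈ W) :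
    Function.Surjective W.dualRestrict := by
  have htf : Module.IsTorsionFree ℤ (M ⧸ W) := by
    rw [Submodule.isTorsionFree_iff_torsion_eq_bot, eq_bot_iff]
    intro x hx
    obtain ⟨v, rfl⟩ := W.mkQ_surjective x
    obtain ⟨k, hk, hkv⟩ := mem_saturation.mp (show v ∈ saturation W from hx)
    exact (Submodule.Quotient.mk_eq_zero W).mpr (hW k v hk hkv)
  have hfree : Module.Free ℤ (M ⧸ W) := Module.free_of_finite_type_torsion_free'
  obtain ⟨s, hs⟩ := Module.projective_lifting_property W.mkQ LinearMap.id W.mkQ_surjective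
  intro f
  have hmem : ∀ v, (LinearMap.id - s ∘ₗ W.mkQ : M →ₗ[ℤ] M) v ∈ W := by
    intro v
    rw [← Submodule.Quotient.mk_eq_zero W]
    change W.mkQ (v - s (W.mkQ v)) = 0
    rw [map_sub, sub_eq_zero]
    exact (LinearMap.congr_fun hs (W.mkQ v)).symm
  refine ⟨f ∘ₗ LinearMap.codRestrict W _ hmem, ?_⟩
  ext x
  change f _ = f x
  congr 1
  refine Subtype.ext ?_
  change (x : M) - s (W.mkQ x) = x
  rw [(Submodule.Quotient.mk_eq_zero W).mpr x.2 |> (show W.mkQ (x : M) = 0 from ·), map_zero,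
    sub_zero]

/-- The map between the Specht modules of a diagram and of its transpose that is given by the
incidence matrix. -/
def spechtMap (h : mu = lam.transpose) (u₀ : Tableau lam n) : Specht lam n →ₗ[ℤ] Specht mu n :=
  ((incidenceMap (eq_transpose_symm h) (u₀.tr h)).codRestrict (spechtSub mu n).toSubmodule
    fun _ => incidenceMap_mem_specht _ _ _) ∘ₗ (spechtSub lam n).toSubmodule.subtype

theorem spechtMap_spechtRep (h : mu = lam.transpose) (u₀ : Tableau lam n) (g : Perm (Fin n)) :
    spechtMap h u₀ ∘ₗ spechtRep lam n g
      = (Perm.sign g : ℤ) • (spechtRep mu n g ∘ₗ spechtMap h u₀) := by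
  ext1 x
  exact Subtype.ext (incidenceMap_tabloidRep (eq_transpose_symm h) (u₀.tr h) g x)

/-- The dual of a Specht lattice is the Specht lattice of the transposed diagram, in such a way
that `eta` corresponds to `spechtMap`. -/
theorem exists_dual_equiv (h : mu = lam.transpose) (u₀ : Tableau lam n) :
    ∃ θ : Specht mu n ≃ₗ[ℤ] Module.Dual ℤ (Specht lam n),
      θ.toLinearMap ∘ₗ spechtMap h u₀ = (eta lam n).toLinearMap := by
  let T' : TabloidModule lam n →ₗ[ℤ] Specht mu n :=
    (incidenceMap (eq_transpose_symm h) (u₀.tr h)).codRestrict (spechtSub mu n).toSubmodule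
      fun _ => incidenceMap_mem_specht _ _ _
  let r : TabloidModule lam n →ₗ[ℤ] Module.Dual ℤ (Specht lam n) :=
    (spechtSub lam n).toSubmodule.dualRestrict ∘ₗ tabloidForm lam n
  have hT' : Function.Surjective T' := fun x => by
    obtain ⟨v, hv⟩ := exists_incidenceMap_eq (eq_transpose_symm h) (u₀.tr h) x
    exact ⟨v, Subtype.ext hv⟩
  have hr : Function.Surjective r :=
    (dualRestrict_surjective_of_pure _ fun k v hk => specht_pure h u₀ hk).comp
      tabloidForm_surjective
  -- Both kernels are the orthogonal complement of S^λ, the image of T, by adjointness.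
  have hker : LinearMap.ker T' = LinearMap.ker r := by
    ext v
    rw [LinearMap.mem_ker, LinearMap.mem_ker, ← Subtype.coe_inj]
    change incidenceMap (eq_transpose_symm h) (u₀.tr h) v = 0 ↔ _
    constructor
    · intro hv
      ext1 x
      obtain ⟨w, hw⟩ := exists_incidenceMap_eq h u₀ x
      change tabloidForm lam n v x = 0
      rw [← hw, tabloidForm_incidenceMap, hv, map_zero, LinearMap.zero_apply]
    · intro hv
      ext t
      rw [← tabloidForm_single_left t, tabloidForm_comm, ← tabloidForm_incidenceMap]
      exact LinearMap.congr_fun hv ⟨_, incidenceMap_mem_specht h u₀ _⟩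
  refine ⟨(T'.quotKerEquivOfSurjective hT').symm ≪≫ₗ Submodule.quotEquivOfEq _ _ hker ≪≫ₗ
    r.quotKerEquivOfSurjective hr, ?_⟩
  ext1 x
  have e : (T'.quotKerEquivOfSurjective hT').symm (spechtMap h u₀ x)
      = Submodule.Quotient.mk (x : TabloidModule lam n) := by
    rw [LinearEquiv.symm_apply_eq]
    rfl
  rw [LinearMap.comp_apply, LinearEquiv.coe_coe, LinearEquiv.trans_apply, LinearEquiv.trans_apply,
    e]
  exact fun y => rfl

theorem exists_spechtMap_scalar (h : mu = lam.transpose) (u₀ : Tableau lam n) :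
    ∃ m : ℕ, m * spechtRank lam n = n ! ∧
      spechtMap (eq_transpose_symm h) (u₀.tr h) ∘ₗ spechtMap h u₀ = (m : ℤ) • LinearMap.id ∧
      spechtMap h u₀ ∘ₗ spechtMap (eq_transpose_symm h) (u₀.tr h) = (m : ℤ) • LinearMap.id := by
  obtain ⟨m, hm₁, hm₂⟩ := exists_scalar h u₀
  have hrank := scalar_mul_spechtRank h u₀ hm₁
  have hpos : 0 < m := by
    have : 0 < m * spechtRank lam n := by rw [hrank]; exact_mod_cast n.factorial_pos
    exact pos_of_mul_pos_left this (Int.natCast_nonneg _)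
  lift m to ℕ using hpos.le
  refine ⟨m, by exact_mod_cast hrank, ?_, ?_⟩
  · ext1 x
    obtain ⟨w, hw⟩ := exists_incidenceMap_eq h u₀ x
    refine Subtype.ext ?_
    change incidenceMap h u₀ (incidenceMap _ _ (x : TabloidModule lam n))
      = (m : ℤ) • (x : TabloidModule lam n)
    rw [← hw, hm₁]
  · ext1 x
    obtain ⟨w, hw⟩ := exists_incidenceMap_eq (eq_transpose_symm h) (u₀.tr h) x
    refine Subtype.ext ?_
    change incidenceMap (eq_transpose_symm h) (u₀.tr h) (incidenceMap h u₀
      (x : TabloidModule mu n)) = (m : ℤ) • (x : TabloidModule mu n)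
    rw [← hw, hm₂]

end Duality

/-! ### Arithmetic of ℤ_(p) and the kernel of reduction modulo p. -/

section Localization

variable (p : ℕ) [Fact p.Prime]

instance : IsDomain (ZLoc p) :=
  IsLocalization.isDomain_of_le_nonZeroDivisors (M := (Ideal.span {(p : ℤ)}).primeCompl) _
    (Ideal.span {(p : ℤ)}).primeCompl_le_nonZeroDivisors

theorem zLoc_isUnit_intCast {c : ℤ} (hc : ¬ (p : ℤ) ∣ c) : IsUnit (c : ZLoc p) := by
  have := IsLocalization.map_units (ZLoc p)
    (⟨c, fun h => hc (Ideal.mem_span_singleton.mp h)⟩ : (Ideal.span {(p : ℤ)}).primeCompl)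
  simpa using this

theorem zLoc_natCast_ne_zero : (p : ZLoc p) ≠ 0 := by
  have := IsLocalization.injective (ZLoc p) (Ideal.span {(p : ℤ)}).primeCompl_le_nonZeroDivisors
  intro h
  have h' : algebraMap ℤ (ZLoc p) p = algebraMap ℤ (ZLoc p) 0 := by simpa using h
  exact (Fact.out : p.Prime).ne_zero (by exact_mod_cast this h')

theorem dvd_of_residueMap_eq_zero {r : ZLoc p} (hr : residueMap p r = 0) : (p : ZLoc p) ∣ r := by
  obtain ⟨⟨a, s⟩, hs⟩ := IsLocalization.surj (Ideal.span {(p : ℤ)}).primeCompl r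
  simp only [eq_intCast] at hs
  have hsu : IsUnit ((s : ℤ) : ZLoc p) :=
    zLoc_isUnit_intCast p fun h => s.2 (Ideal.mem_span_singleton.mpr h)
  have ha : (a : ZMod p) = 0 := by
    rw [← map_intCast (residueMap p), ← hs, map_mul, hr, zero_mul]
  obtain ⟨b, rfl⟩ := (ZMod.intCast_zmod_eq_zero_iff_dvd _ _).mp ha
  rw [← hsu.dvd_mul_right, hs]
  exact ⟨b, by push_cast; ring⟩

theorem reduction_eq_zero_iff {X : Type*} [AddCommGroup X] (x : ZLoc p ⊗[ℤ] X) :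
    reduction p X x = 0 ↔ ∃ y, x = (p : ZLoc p) • y := by
  constructor
  · intro hx
    let f : ZLoc p →ₗ[ℤ] ZLoc p := (LinearMap.mulLeft ℤ (p : ZLoc p))
    let g : ZLoc p →ₗ[ℤ] ZMod p := (residueMap p).toIntAlgHom.toLinearMap
    have hex : Function.Exact f g := by
      intro r
      constructor
      · intro hr
        obtain ⟨s, rfl⟩ := dvd_of_residueMap_eq_zero p (r := r) hr
        exact ⟨s, rfl⟩
      · rintro ⟨s, rfl⟩
        change residueMap p ((p : ZLoc p) * s) = 0
        rw [map_mul, map_natCast, ZMod.natCast_self, zero_mul]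
    -- Right exactness of the tensor product, applied to multiplication by p on ℤ_(p) followed by
    -- the residue map.
    obtain ⟨y, rfl⟩ := (rTensor_exact X hex
      (RingHomSurjective.is_surjective (σ := residueMap p)) x).mp hx
    refine ⟨y, ?_⟩
    clear hx
    induction y using TensorProduct.induction_on with
    | zero => simp
    | tmul a x => rfl
    | add a b ha hb => rw [map_add, smul_add, ha, hb]
  · rintro ⟨y, rfl⟩
    rw [LinearMap.map_smulₛₗ, map_natCast, ZMod.natCast_self, zero_smul]

end Localization

/-! ### Comparison of the Jantzen subquotients in complementary degrees. -/

section JantzenDuality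

variable (p : ℕ) [Fact p.Prime] {lam mu : YoungDiagram} {n : ℕ}

/-- The base change of `spechtMap` to `ℤ_(p)`. -/
def spechtMapLoc (h : mu = lam.transpose) (u₀ : Tableau lam n) :
    ZLoc p ⊗[ℤ] Specht lam n →ₗ[ZLoc p] ZLoc p ⊗[ℤ] Specht mu n :=
  (spechtMap h u₀).baseChange (ZLoc p)

variable {p} in
-- Since η is `spechtMap` followed by an isomorphism, the filtration can be read off from
-- divisibility of φ x in the transposed Specht lattice.
theorem mem_jantzenPreimage_iff (h : mu = lam.transpose) (u₀ : Tableau lam n) {i : ℕ}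
    {x : ZLoc p ⊗[ℤ] Specht lam n} :
    x ∈ jantzenPreimage p lam n i ↔ ∃ y, spechtMapLoc p h u₀ x = (p : ZLoc p) ^ i • y := by
  obtain ⟨θ, hθ⟩ := exists_dual_equiv h u₀
  let Θ := θ.baseChange ℤ (ZLoc p) _ _
  have hη : ∀ x, (eta lam n).toLinearMap.baseChange (ZLoc p) x = Θ (spechtMapLoc p h u₀ x) := by
    intro x
    rw [← hθ, LinearMap.baseChange_comp]
    rfl
  rw [jantzenPreimage, Submodule.mem_comap, hη]
  constructor
  · rintro ⟨z, -, hz⟩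
    refine ⟨Θ.symm z, ?_⟩
    rw [← map_smul, LinearEquiv.eq_symm_apply]
    exact hz.symm
  · rintro ⟨y, hy⟩
    rw [hy, map_smul]
    exact ⟨Θ y, trivial, rfl⟩

theorem pow_smul_cancel (i : ℕ) {x y : ZLoc p ⊗[ℤ] Specht lam n}
    (hxy : (p : ZLoc p) ^ i • x = (p : ZLoc p) ^ i • y) : x = y :=
  smul_right_injective _ (pow_ne_zero i (zLoc_natCast_ne_zero p)) hxy

theorem spechtMapLoc_comp (h : mu = lam.transpose) (u₀ : Tableau lam n) {m : ℕ}
    (hm : spechtMap (eq_transpose_symm h) (u₀.tr h) ∘ₗ spechtMap h u₀ = (m : ℤ) • LinearMap.id)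
    (x : ZLoc p ⊗[ℤ] Specht lam n) :
    spechtMapLoc p (eq_transpose_symm h) (u₀.tr h) (spechtMapLoc p h u₀ x) = (m : ZLoc p) • x := by
  have := congrArg (LinearMap.baseChange (ZLoc p)) hm
  rw [LinearMap.baseChange_comp] at this
  have := LinearMap.congr_fun this x
  rw [LinearMap.baseChange_smul, LinearMap.baseChange_id] at this
  refine this.trans ?_
  simp [Nat.cast_smul_eq_nsmul]

theorem spechtMapLoc_rep (h : mu = lam.transpose) (u₀ : Tableau lam n) (g : Perm (Fin n))
    (x : ZLoc p ⊗[ℤ] Specht lam n) :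
    spechtMapLoc p h u₀ (baseChangeRep (ZLoc p) (spechtRep lam n) g x)
      = (Perm.sign g : ℤ) • baseChangeRep (ZLoc p) (spechtRep mu n) g (spechtMapLoc p h u₀ x) := by
  have := congrArg (LinearMap.baseChange (ZLoc p)) (spechtMap_spechtRep h u₀ g)
  rw [LinearMap.baseChange_smul, LinearMap.baseChange_comp, LinearMap.baseChange_comp] at this
  exact LinearMap.congr_fun this x

theorem exists_unit_factor {m : ℕ} (hm : m ≠ 0) :
    ∃ ε : (ZLoc p)ˣ, (m : ZLoc p) = (p : ZLoc p) ^ padicValNat p m * ε := by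
  obtain ⟨c, hc⟩ := pow_padicValNat_dvd (p := p) (n := m)
  have hcp : ¬ (p : ℤ) ∣ (c : ℤ) := by
    intro hd
    obtain ⟨d, rfl⟩ := Int.natCast_dvd_natCast.mp hd
    refine pow_succ_padicValNat_not_dvd (p := p) hm ⟨d, ?_⟩
    rw [pow_succ, mul_assoc]
    exact hc
  obtain ⟨ε, hε⟩ := zLoc_isUnit_intCast p hcp
  refine ⟨ε, ?_⟩
  rw [hε, Int.cast_natCast]
  exact_mod_cast congrArg (Nat.cast (R := ZLoc p)) hc

/-- The projection of `(p^i S^{lam,*}) η⁻¹` onto the `i`-th Jantzen subquotient. -/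
def toSubquotient (lam : YoungDiagram) (n i : ℕ) :
    jantzenPreimage p lam n i →+ JantzenSubquotient p lam n i where
  toFun x := Submodule.Quotient.mk ⟨reduction p _ x, x, x.2, rfl⟩
  map_zero' := by
    rw [Submodule.Quotient.mk_eq_zero]
    change reduction p (Specht lam n) 0 ∈ (jantzen p lam n (i + 1)).toSubmodule
    rw [map_zero]
    exact zero_mem _
  map_add' x y := by
    rw [← Submodule.Quotient.mk_add]
    congr 1
    exact Subtype.ext (map_add _ _ _)

variable {p}

theorem toSubquotient_surjective (i : ℕ) : Function.Surjective (toSubquotient p lam n i) := by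
  intro z
  obtain ⟨⟨_, x, hx, rfl⟩, rfl⟩ := Submodule.Quotient.mk_surjective _ z
  exact ⟨⟨x, hx⟩, rfl⟩

theorem toSubquotient_eq_zero_iff {i : ℕ} (x : jantzenPreimage p lam n i) :
    toSubquotient p lam n i x = 0 ↔
      ∃ a ∈ jantzenPreimage p lam n (i + 1), ∃ b, (x : ZLoc p ⊗[ℤ] Specht lam n)
        = a + (p : ZLoc p) • b := by
  refine (Submodule.Quotient.mk_eq_zero _).trans ?_
  change reduction p _ (x : ZLoc p ⊗[ℤ] Specht lam n) ∈ (jantzen p lam n (i + 1)).toSubmodule ↔ _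
  constructor
  · rintro ⟨a, ha, he⟩
    obtain ⟨b, hb⟩ := (reduction_eq_zero_iff p ((x : ZLoc p ⊗[ℤ] Specht lam n) - a)).mp (by
      rw [map_sub, sub_eq_zero]; exact he.symm)
    exact ⟨a, ha, b, by rw [← hb, add_sub_cancel]⟩
  · rintro ⟨a, ha, b, hb⟩
    refine ⟨a, ha, ?_⟩
    have := (reduction_eq_zero_iff p ((p : ZLoc p) • b)).mpr ⟨b, rfl⟩
    rw [hb, map_add, this, add_zero]

theorem toSubquotient_rep {i : ℕ} (g : Perm (Fin n)) (x : jantzenPreimage p lam n i) :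
    toSubquotient p lam n i ⟨_, jantzenPreimage_stable p g x.2⟩
      = jantzenSubquotientRep p lam n i g (toSubquotient p lam n i x) := by
  refine congrArg Submodule.Quotient.mk (Subtype.ext ?_)
  exact reduction_baseChangeRep p _ g _

/-- Apply ψ and cancel p^i. In particular y = p^{-i} φ x lies in the preimage of degree `j` for the
transposed diagram. -/
theorem spechtMapLoc_transpose_eq (h : mu = lam.transpose) (u₀ : Tableau lam n) {N i j : ℕ}
    (hij : i + j = N) {ε : ZLoc p}
    (hψφ : ∀ x, spechtMapLoc p (eq_transpose_symm h) (u₀.tr h) (spechtMapLoc p h u₀ x)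
      = ((p : ZLoc p) ^ N * ε) • x)
    {x y} (hxy : spechtMapLoc p h u₀ x = (p : ZLoc p) ^ i • y) :
    spechtMapLoc p (eq_transpose_symm h) (u₀.tr h) y = (p : ZLoc p) ^ j • ε • x := by
  refine pow_smul_cancel p i ?_
  rw [← map_smul, ← hxy, hψφ, smul_smul, smul_smul, ← pow_add,
    hij]

/-- Write x = a + p b with φ a = p^{i+1} c. Then p^i (y - p c) = p φ b, and applying ψ gives ψ (y -
p c) = p^{j+1} ε b; so y is in the next preimage modulo p. -/
theorem toSubquotient_eq_zero_of_eq (h : mu = lam.transpose) (u₀ : Tableau lam n) {N i j : ℕ}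
    (hij : i + j = N) {ε : ZLoc p}
    (hψφ : ∀ x, spechtMapLoc p (eq_transpose_symm h) (u₀.tr h) (spechtMapLoc p h u₀ x)
      = ((p : ZLoc p) ^ N * ε) • x)
    (x : jantzenPreimage p lam n i) (y : jantzenPreimage p mu n j)
    (hxy : spechtMapLoc p h u₀ x = (p : ZLoc p) ^ i • (y : ZLoc p ⊗[ℤ] Specht mu n))
    (hx : toSubquotient p lam n i x = 0) : toSubquotient p mu n j y = 0 := by
  rw [toSubquotient_eq_zero_iff] at hx ⊢
  obtain ⟨a, ha, b, hb⟩ := hx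
  obtain ⟨c, hc⟩ := (mem_jantzenPreimage_iff h u₀).mp ha
  refine ⟨y - (p : ZLoc p) • c, ?_, c, by rw [sub_add_cancel]⟩
  rw [mem_jantzenPreimage_iff (eq_transpose_symm h) (u₀.tr h)]
  refine ⟨ε • b, pow_smul_cancel p i ?_⟩
  rw [← map_smul, smul_sub, smul_smul, ← pow_succ, ← hxy, ← hc, ← map_sub, hb, add_sub_cancel_left,
    map_smul, map_smul, hψφ, smul_smul, smul_smul, smul_smul]
  congr 1
  rw [← mul_assoc, ← pow_add, ← pow_succ', ← hij, add_assoc]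

/-- The Jantzen subquotients of `lam` and of its transpose in complementary degrees are
isomorphic via `x ↦ p^{-i} φ x`, where `φ` is `spechtMapLoc`. -/
theorem exists_subquotient_addEquiv (h : mu = lam.transpose) (u₀ : Tableau lam n) {N i j : ℕ}
    (hij : i + j = N) (ε : (ZLoc p)ˣ)
    (hψφ : ∀ x, spechtMapLoc p (eq_transpose_symm h) (u₀.tr h) (spechtMapLoc p h u₀ x)
      = ((p : ZLoc p) ^ N * ε) • x)
    (hφψ : ∀ y, spechtMapLoc p h u₀ (spechtMapLoc p (eq_transpose_symm h) (u₀.tr h) y)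
      = ((p : ZLoc p) ^ N * ε) • y) :
    ∃ E : JantzenSubquotient p lam n i ≃+ JantzenSubquotient p mu n j,
      ∀ (x : jantzenPreimage p lam n i) (y : jantzenPreimage p mu n j),
        spechtMapLoc p h u₀ x = (p : ZLoc p) ^ i • (y : ZLoc p ⊗[ℤ] Specht mu n) →
        E (toSubquotient p lam n i x) = toSubquotient p mu n j y := by
  have hex : ∀ x : jantzenPreimage p lam n i, ∃ y : jantzenPreimage p mu n j,
      spechtMapLoc p h u₀ x = (p : ZLoc p) ^ i • (y : ZLoc p ⊗[ℤ] Specht mu n) := by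
    intro x
    obtain ⟨y, hy⟩ := (mem_jantzenPreimage_iff h u₀).mp x.2
    exact ⟨⟨y, (mem_jantzenPreimage_iff (eq_transpose_symm h) (u₀.tr h)).mpr
      ⟨_, spechtMapLoc_transpose_eq h u₀ hij hψφ hy⟩⟩, hy⟩
  choose e he using hex
  have huniq : ∀ (x : jantzenPreimage p lam n i) (y : jantzenPreimage p mu n j),
      spechtMapLoc p h u₀ x = (p : ZLoc p) ^ i • (y : ZLoc p ⊗[ℤ] Specht mu n) → e x = y :=
    fun x y hxy => Subtype.ext (pow_smul_cancel p i ((he x).symm.trans hxy))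
  let e' : jantzenPreimage p lam n i →+ jantzenPreimage p mu n j :=
    AddMonoidHom.mk' e fun x y => huniq _ _ (by
      rw [Submodule.coe_add, Submodule.coe_add, map_add, he, he, smul_add])
  -- If ψ y = p^j z, then φ z = p^i ε y, so x = ε⁻¹ z is the preimage sought.
  have hback : ∀ y : jantzenPreimage p mu n j, ∃ x : jantzenPreimage p lam n i,
      spechtMapLoc p h u₀ x = (p : ZLoc p) ^ i • (y : ZLoc p ⊗[ℤ] Specht mu n) := by
    intro y
    obtain ⟨z, hz⟩ := (mem_jantzenPreimage_iff (eq_transpose_symm h) (u₀.tr h)).mp y.2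
    have hz' := spechtMapLoc_transpose_eq (eq_transpose_symm h) (u₀.tr h)
      (i := j) (j := i) ((add_comm j i).trans hij) hφψ hz
    have key : spechtMapLoc p h u₀ ((↑ε⁻¹ : ZLoc p) • z) = (p : ZLoc p) ^ i • (y : _) := by
      refine ((map_smul _ _ _).trans (congrArg _ hz')).trans ?_
      rw [smul_smul, smul_smul, mul_right_comm, Units.inv_mul, one_mul]
    exact ⟨⟨_, (mem_jantzenPreimage_iff h u₀).mpr ⟨_, key⟩⟩, key⟩
  let f : jantzenPreimage p lam n i →+ JantzenSubquotient p mu n j :=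
    (toSubquotient p mu n j).comp e'
  have hf : Function.Surjective f := by
    intro z
    obtain ⟨y, rfl⟩ := toSubquotient_surjective _ z
    obtain ⟨x, hx⟩ := hback y
    exact ⟨x, congrArg (toSubquotient p mu n j) (huniq x y hx)⟩
  -- For the converse inclusion the same argument runs from y back to ε x, and the unit is removed
  -- afterwards.
  have hker : (toSubquotient p lam n i).ker = f.ker := by
    ext x
    rw [AddMonoidHom.mem_ker, AddMonoidHom.mem_ker]
    refine ⟨fun hx => toSubquotient_eq_zero_of_eq h u₀ hij hψφ x (e x) (he x) hx, fun hx => ?_⟩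
    have hx' : toSubquotient p mu n j (e x) = 0 := hx
    have h₁ := spechtMapLoc_transpose_eq h u₀ hij hψφ (he x)
    have h₂ := toSubquotient_eq_zero_of_eq (eq_transpose_symm h) (u₀.tr h) (i := j) (j := i)
      ((add_comm j i).trans hij) hφψ (e x) ⟨_, Submodule.smul_mem _ (ε : ZLoc p) x.2⟩ h₁ hx'
    rw [toSubquotient_eq_zero_iff] at h₂ ⊢
    obtain ⟨a, ha, b, hb⟩ := h₂
    refine ⟨(↑ε⁻¹ : ZLoc p) • a, Submodule.smul_mem _ _ ha, (↑ε⁻¹ : ZLoc p) • b, ?_⟩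
    have h₃ := congrArg ((↑ε⁻¹ : ZLoc p) • ·) hb
    simp only [smul_smul, Units.inv_mul, one_smul, smul_add] at h₃
    rw [h₃, smul_smul, mul_comm (p : ZLoc p)]
  refine ⟨(QuotientAddGroup.quotientKerEquivOfSurjective _
    (toSubquotient_surjective i)).symm.trans
    ((QuotientAddGroup.quotientAddEquivOfEq hker).trans
      (QuotientAddGroup.quotientKerEquivOfSurjective f hf)), fun x y hxy => ?_⟩
  have : (QuotientAddGroup.quotientKerEquivOfSurjective _ (toSubquotient_surjective i)).symm
      (toSubquotient p lam n i x) = QuotientAddGroup.mk x := by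
    rw [AddEquiv.symm_apply_eq]
    rfl
  rw [AddEquiv.trans_apply, this, ← huniq x y hxy]
  rfl

/-- From φ x = p^i y follows p^N ε x = p^i ψ y. Cancelling p^N leaves x divisible by p, as i > N, so
x reduces to zero. -/
theorem subsingleton_subquotient (h : mu = lam.transpose) (u₀ : Tableau lam n) {N i : ℕ}
    (hi : N < i) (ε : (ZLoc p)ˣ)
    (hψφ : ∀ x, spechtMapLoc p (eq_transpose_symm h) (u₀.tr h) (spechtMapLoc p h u₀ x)
      = ((p : ZLoc p) ^ N * ε) • x) :
    Subsingleton (JantzenSubquotient p lam n i) := by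
  refine subsingleton_of_forall_eq 0 fun z => ?_
  obtain ⟨x, rfl⟩ := toSubquotient_surjective i z
  rw [toSubquotient_eq_zero_iff]
  obtain ⟨y, hy⟩ := (mem_jantzenPreimage_iff h u₀).mp x.2
  refine ⟨0, zero_mem _, (p : ZLoc p) ^ (i - N - 1) • (↑ε⁻¹ : ZLoc p) •
    spechtMapLoc p (eq_transpose_symm h) (u₀.tr h) y, pow_smul_cancel p N ?_⟩
  have := hψφ x
  rw [hy, map_smul] at this
  have h₂ := congrArg ((↑ε⁻¹ : ZLoc p) • ·) this
  simp only [smul_smul] at h₂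
  rw [mul_left_comm, Units.inv_mul, mul_one] at h₂
  rw [← h₂, zero_add, smul_smul, smul_smul, smul_smul]
  congr 1
  rw [mul_comm, ← pow_succ, ← pow_add]
  congr 2
  omega

end JantzenDuality

/-! ### The sign twist as multiplication of the operation by the sign character. -/

section SignTwist

/-- All tableaux of column shape have the same column tabloid, so all polytabloids agree up to sign
and a single one spans the lattice. -/
theorem exists_specht_column_equiv (n : ℕ) :
    ∃ e : Specht (columnDiagram n) n ≃ₗ[ℤ] ℤ, ∀ (g : Perm (Fin n)) x,
      e (spechtRep (columnDiagram n) n g x) = Perm.sign g * e x := by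
  have hcol : ∀ a : Tableau (columnDiagram n) n, a.colOf = 0 := by
    intro a
    ext x
    have := a.mem_shape x
    rw [← YoungDiagram.mem_cells] at this
    simp only [columnDiagram, Finset.mem_product, Finset.mem_singleton] at this
    exact this.2
  have hcard : Fintype.card {c : ℕ × ℕ // c ∈ (columnDiagram n).cells} = n := by
    rw [Fintype.card_coe]; simp [columnDiagram]
  let a : Tableau (columnDiagram n) n := Fintype.equivFinOfCardEq hcard
  have hsign : ∀ g : Perm (Fin n), polytabloid (a.perm g) = (Perm.sign g : ℤ) • polytabloid a := by
    intro g
    have e : Tabloid.mk ((a.perm g).tr rfl) = Tabloid.mk (a.tr rfl) := by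
      rw [Tabloid.mk_eq_mk, Tableau.rowOf_tr, Tableau.rowOf_tr, hcol, hcol]
    rw [polytabloid_eq rfl a (a.perm g), e, polytabloid_eq rfl a a, Tableau.sgn_perm, mul_smul]
  have hne : polytabloid a ≠ 0 := by
    intro h0
    have := DFunLike.congr_fun h0 (Tabloid.mk a)
    rw [polytabloid_eq rfl a a, Finsupp.smul_apply, incidenceMap_single_apply, incidence_mk,
      Tableau.sgn_self] at this
    simp at this
  have hspan : (spechtSub (columnDiagram n) n).toSubmodule = Submodule.span ℤ {polytabloid a} := by
    refine le_antisymm (Submodule.span_le.mpr ?_) (Submodule.span_mono ?_)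
    · rintro _ ⟨b, rfl⟩
      obtain ⟨g, rfl⟩ := a.exists_perm b
      rw [hsign]
      exact Submodule.smul_mem _ _ (Submodule.mem_span_singleton_self _)
    · rintro _ rfl
      exact ⟨a, rfl⟩
  let e := LinearEquiv.ofEq _ _ hspan ≪≫ₗ
    (LinearEquiv.toSpanNonzeroSingleton ℤ _ (polytabloid a) hne).symm
  refine ⟨e, fun g x => ?_⟩
  obtain ⟨c, rfl⟩ := e.symm.surjective x
  rw [LinearEquiv.apply_symm_apply, ← LinearEquiv.eq_symm_apply]
  refine Subtype.ext ?_
  change tabloidRep _ n g (c • polytabloid a) = ((Perm.sign g : ℤ) * c) • polytabloid a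
  rw [map_zsmul, tabloidRep_polytabloid, hsign, smul_smul, mul_comm]

theorem exists_signTwist_equiv {k X : Type*} [CommRing k] [AddCommGroup X] [Module k X] {n : ℕ}
    (ρ : Representation k (Perm (Fin n)) X) :
    ∃ e : (X ⊗[ℤ] Specht (columnDiagram n) n) ≃ₗ[k] X, ∀ (g : Perm (Fin n)) x,
      e (signTwist ρ g x) = (Perm.sign g : ℤ) • ρ g (e x) := by
  obtain ⟨c, hc⟩ := exists_specht_column_equiv n
  refine ⟨TensorProduct.AlgebraTensorModule.congr (LinearEquiv.refl k X) c ≪≫ₗ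
    TensorProduct.AlgebraTensorModule.rid ℤ k X, fun g x => ?_⟩
  induction x using TensorProduct.induction_on with
  | zero => simp
  | add x y hx hy => rw [map_add, map_add, hx, hy, map_add, map_add, smul_add]
  | tmul x s =>
    change c (spechtRep (columnDiagram n) n g s) • ρ g x = (Perm.sign g : ℤ) • ρ g (c s • x)
    rw [hc, mul_smul, map_zsmul]

end SignTwist

/-- φ commutes with permutations up to sign, and the relation φ x = p^i y characterizing `E`
inherits this; the twist absorbs the sign. -/
theorem exists_subquotient_equiv_signTwist {n : ℕ} {p : ℕ} [Fact p.Prime]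
    {lam mu : YoungDiagram} (h : mu = lam.transpose) (u₀ : Tableau lam n) {N i j : ℕ}
    (hij : i + j = N) (ε : (ZLoc p)ˣ)
    (hψφ : ∀ x, spechtMapLoc p (eq_transpose_symm h) (u₀.tr h) (spechtMapLoc p h u₀ x)
      = ((p : ZLoc p) ^ N * ε) • x)
    (hφψ : ∀ y, spechtMapLoc p h u₀ (spechtMapLoc p (eq_transpose_symm h) (u₀.tr h) y)
      = ((p : ZLoc p) ^ N * ε) • y) :
    Nonempty (Representation.Equiv (jantzenSubquotientRep p lam n i)
      (signTwist (jantzenSubquotientRep p mu n j))) := by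
  obtain ⟨E, hE⟩ := exists_subquotient_addEquiv h u₀ hij ε hψφ hφψ
  obtain ⟨S, hS⟩ := exists_signTwist_equiv (jantzenSubquotientRep p mu n j)
  have hEg : ∀ (g : Perm (Fin n)) z, E (jantzenSubquotientRep p lam n i g z)
      = (Perm.sign g : ℤ) • jantzenSubquotientRep p mu n j g (E z) := by
    intro g z
    obtain ⟨x, rfl⟩ := toSubquotient_surjective i z
    obtain ⟨y', hy'⟩ := (mem_jantzenPreimage_iff h u₀).mp x.2
    let y : jantzenPreimage p mu n j :=
      ⟨y', (mem_jantzenPreimage_iff (eq_transpose_symm h) (u₀.tr h)).mpr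
        ⟨_, spechtMapLoc_transpose_eq h u₀ hij hψφ hy'⟩⟩
    have hxy : spechtMapLoc p h u₀ x = (p : ZLoc p) ^ i • (y : ZLoc p ⊗[ℤ] Specht mu n) := hy'
    rw [hE x y hxy, ← toSubquotient_rep, ← toSubquotient_rep, ← map_zsmul]
    refine hE _ _ ?_
    rw [spechtMapLoc_rep, hxy, map_smul, smul_comm]
    rfl
  -- Additive maps between 𝔽_p-vector spaces are automatically linear.
  let L : JantzenSubquotient p lam n i ≃ₗ[ZMod p] JantzenSubquotient p mu n j :=
    { E with map_smul' := fun c x => ZMod.map_smul E.toAddMonoidHom c x }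
  refine ⟨Representation.Equiv.mk (L ≪≫ₗ S.symm) fun g => ?_⟩
  refine LinearMap.ext fun z => ?_
  change S.symm (E (jantzenSubquotientRep p lam n i g z)) = signTwist _ g (S.symm (E z))
  rw [LinearEquiv.symm_apply_eq, hS, LinearEquiv.apply_symm_apply, hEg]

end SpechtJantzen

end

open SpechtJantzen in
theorem SpechtJantzen.exists_unit_scalar {n p : ℕ} [Fact p.Prime] {lam mu : YoungDiagram}
    (h : mu = lam.transpose) (u₀ : Tableau lam n) :
    spechtRank lam n ∣ n ! ∧ ∃ ε : (ZLoc p)ˣ,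
      (∀ x, spechtMapLoc p (eq_transpose_symm h) (u₀.tr h) (spechtMapLoc p h u₀ x)
        = ((p : ZLoc p) ^ padicValNat p (n ! / spechtRank lam n) * ε) • x) ∧
      ∀ y, spechtMapLoc p h u₀ (spechtMapLoc p (eq_transpose_symm h) (u₀.tr h) y)
        = ((p : ZLoc p) ^ padicValNat p (n ! / spechtRank lam n) * ε) • y := by
  obtain ⟨m, hm, h₁, h₂⟩ := exists_spechtMap_scalar h u₀
  have hne : m * spechtRank lam n ≠ 0 := hm ▸ n.factorial_ne_zero
  have hdiv : n ! / spechtRank lam n = m := by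
    rw [← hm, Nat.mul_div_cancel _ (Nat.pos_of_ne_zero (right_ne_zero_of_mul hne))]
  obtain ⟨ε, hε⟩ := exists_unit_factor p (left_ne_zero_of_mul hne)
  refine ⟨⟨m, by rw [mul_comm, hm]⟩, ε, fun x => ?_, fun y => ?_⟩
  · rw [hdiv, ← hε, spechtMapLoc_comp p h u₀ h₁]
  · rw [hdiv, ← hε]
    exact spechtMapLoc_comp p (eq_transpose_symm h) (u₀.tr h) h₂ y

theorem mainTheorem5 (n : ℕ) (hn : 1 ≤ n) (p : ℕ) [Fact p.Prime]
    (lam : YoungDiagram) (hlam : lam.card = n) :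
    SpechtJantzen.spechtRank lam n ∣ n ! ∧
    (∀ i : ℕ, i ≤ padicValNat p (n ! / SpechtJantzen.spechtRank lam n) →
      Nonempty (Representation.Equiv
        (SpechtJantzen.jantzenSubquotientRep p lam n i)
        (SpechtJantzen.signTwist
          (SpechtJantzen.jantzenSubquotientRep p lam.transpose n
            (padicValNat p (n ! / SpechtJantzen.spechtRank lam n) - i))))) ∧
    (∀ i : ℕ, padicValNat p (n ! / SpechtJantzen.spechtRank lam n) < i →
      Subsingleton (SpechtJantzen.JantzenSubquotient p lam n i)) := by
  have hcard : Fintype.card {c : ℕ × ℕ // c ∈ lam.cells} = n := (Fintype.card_coe _).trans hlam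
  obtain ⟨hdvd, ε, h₁, h₂⟩ := SpechtJantzen.exists_unit_scalar (p := p) (lam := lam) rfl
    (Fintype.equivFinOfCardEq hcard)
  exact ⟨hdvd, fun i hi => SpechtJantzen.exists_subquotient_equiv_signTwist rfl _
    (Nat.add_sub_cancel' hi) ε h₁ h₂,
    fun i hi => SpechtJantzen.subsingleton_subquotient rfl _ hi ε h₁⟩
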